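/- Let $n\ge 0$ and let $x,y\in M_n(\mathbb C)$ be self-adjoint, with $\|y\|<\pi$, where $\|\cdot\|$ is the spectral norm (so that $iy$ is the principal logarithm of $e^{iy}$). Let $t_0>0$ and let $u(t)=e^{itx}e^{iy}$ satisfy $\|u(t)-1\|<\sqrt2$ for all $t\in[0,t_0]$. For $t\in[0,t_0]$ let $z(t)$ be the self-adjoint matrix with $e^{iz(t)}=u(t)$ and $\|z(t)\|<\pi$, and let $e^{i\theta_1(t)},\dots,e^{i\theta_n(t)}$ be the eigenvalues of $u(t)$, repeated according to multiplicity, with $\pi>\theta_1(t)\ge\theta_2(t)\ge\dots\ge\theta_n(t)>-\pi$. Let $\mu_1>\mu_2>\dots>\mu_n$ be real numbers and $\mu=\mathrm{diag}(\mu_1,\dots,\mu_n)$. Then, for all $t\in[0,t_0]$, $$f_\mu(t):=\sum_{k=1}^n\mu_k\theta_k(t)=\sup_{w\in U_n(\mathbb C)}\operatorname{tr}\bigl(w\mu w^{-1}z(t)\bigr),$$ and the following hold. (1) $f_\mu$ is strictly convex on $[0,t_0]$ if and only if $x$ and $y$ do not commute. (2) If $x$ and $y$ commute, then $f_\mu$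 is piecewise linear on $[0,t_0]$, i.e. there is a finite partition $0=s_0<s_1<\dots<s_N=t_0$ such that $f_\mu$ is of the form $t\mapsto ct+d$ on each $[s_{i},s_{i+1}]$. (3) If $0\le a<b\le t_0$ and for every $1\le m\le n-1$ the function $t\mapsto\sum_{k=1}^m\theta_k(t)$ is of the form $t\mapsto ct+d$ on $[a,b]$, then $x$ and $y$ commute. -/

import Mathlib

open scoped Matrix.Norms.L2Operator

namespace UnitarySegment

noncomputable section

/-- The segment `u(t) = e^{itx} e^{iy}` of complex `n × n` matrices. -/
def expPath {n : ℕ} (x y : Matrix (Fin n) (Fin n) ℂ) (t : ℝ) : Matrix (Fin n) (Fin n) ℂ :=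
  NormedSpace.exp ((Complex.I * (t : ℂ)) • x) * NormedSpace.exp (Complex.I • y)

/-- `z` is the self-adjoint matrix for which `iz` is the principal logarithm of the unitary matrix
`u`: it satisfies `e^{iz} = u` and has spectral norm less than `π`. -/
structure IsPrincipalArg {n : ℕ} (u z : Matrix (Fin n) (Fin n) ℂ) : Prop where
  isHermitian : z.IsHermitian
  norm_lt : ‖z‖ < Real.pi
  exp_eq : NormedSpace.exp (Complex.I • z) = u

/-- `θ` lists the arguments in `(-π, π)` of the eigenvalues of `u`, in non-increasing order and
repeated according to multiplicity. -/
structure IsEigenangles {n : ℕ} (u : Matrix (Fin n) (Fin n) ℂ) (θ : Fin n → ℝ) : Prop where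
  antitone : Antitone θ
  mem_Ioo : ∀ k, θ k ∈ Set.Ioo (-Real.pi) Real.pi
  charpoly_eq : u.charpoly =
    ∏ k, (Polynomial.X - Polynomial.C (Complex.exp ((θ k : ℂ) * Complex.I)))

/-- The function `t ↦ μ₁ θ₁(t) + ⋯ + μₙ θₙ(t)`. -/
def weightedAngleSum {n : ℕ} (μ : Fin n → ℝ) (θ : ℝ → Fin n → ℝ) (t : ℝ) : ℝ :=
  ∑ k, μ k * θ t k

/-- The values `tr(w μ w⁻¹ z)`, `w` unitary, where `μ` stands for the diagonal matrix with these
entries. The trace is real when `z` is self-adjoint. -/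
def orbitTraces {n : ℕ} (μ : Fin n → ℝ) (z : Matrix (Fin n) (Fin n) ℂ) : Set ℝ :=
  Set.range fun w : Matrix.unitaryGroup (Fin n) ℂ =>
    (Matrix.trace ((w : Matrix (Fin n) (Fin n) ℂ) * Matrix.diagonal (fun k => (μ k : ℂ)) *
      ((w⁻¹ : Matrix.unitaryGroup (Fin n) ℂ) : Matrix (Fin n) (Fin n) ℂ) * z)).re

/-- `f` is linear, in the sense `f(t) = c t + d`, on `[a, b]`. -/
def LinearOnIcc (f : ℝ → ℝ) (a b : ℝ) : Prop :=
  ∃ c d : ℝ, ∀ t ∈ Set.Icc a b, f t = c * t + d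

/-- `f` is piecewise linear on `[a, b]`: there is a finite partition
`a = s₀ < s₁ < ⋯ < s_N = b` such that `f` is linear on each closed interval `[sᵢ, sᵢ₊₁]`
(so that `f` is continuous on `[a, b]`). -/
def PiecewiseLinearOnIcc (f : ℝ → ℝ) (a b : ℝ) : Prop :=
  ∃ (N : ℕ) (s : Fin (N + 1) → ℝ), StrictMono s ∧ s 0 = a ∧ s (Fin.last N) = b ∧
    ∀ i : Fin N, LinearOnIcc f (s i.castSucc) (s i.succ)

end

end UnitarySegment

/-! Everything rests on a first-order lower estimate, obtained without differentiating eigenvalues.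
Write `u' = e^{isx} u` and compare diagonal entries of `u' u⁻¹ = e^{isx}` in an orthonormal
eigenbasis of `u`. With `p`, `q` the doubly stochastic matrices of squared inner products between
that basis and the eigenbases of `u'` and `x`, this reads `∑ p k l e^{i(θ' l - θ k)} = ∑ q k j e^{i
s a j}`. Real parts show that the averages of `1 - cos (θ' l - θ k)` are `O(s²)`. As long as the
differences stay away from `±2π`, this also controls `x - sin x`, so imaginary parts give `∑ p k l
θ' l = θ k + s ∑ q k j a j + O(s²)`. Averaging by a doubly stochastic matrix cannot raise the
pairing with a non-increasing `μ` (Birkhoff and rearrangement), so `f_μ` satisfies a lower bound of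
first order with quadratic error (`sum_mul_add_le_of_angleConj_eq_mul`).

Splitting one factor of a product into `N` small steps and letting `N → ∞` makes the weighted angle
sum subadditive on unitaries with spectrum in the open right half-plane
(`sum_mul_le_of_angleConj_eq_mul`). The hypothesis `‖u(t) - 1‖ < √2` is this spectral condition.
Since `u(t)²` is a conjugate of `u(t+s)` times `u(t-s)`, subadditivity yields midpoint convexity of
`f_μ`. The estimate also makes `f_μ` Lipschitz, hence convex for every non-increasing `μ`.

For rigidity, suppose all angles are linear on an interval. The two-sided estimate identifies the
slope `c k` as the mean of the eigenvalues of `x` under row `k` of the overlap of eigenbases. The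
second derivative of `tr u(t)` then says that the variances of these distributions, weighted by `cos
(θ k) > 0`, sum to zero. They all vanish, so `x` is diagonal in an eigenbasis of `u(t)` and commutes
with `u(t)`, hence with `e^{iy}` and with `y` (`IsAnglePath.unitaryConj_eq`).

If strict convexity fails, `f_μ` meets a chord. Strictly decreasing `μ` is a positive multiple of
the indicator of any initial segment plus a non-increasing remainder, so every partial angle sum is
linear there and rigidity applies. In the commuting case `f_μ` is a maximum, over permutations, of
linear functions. -/

namespace UnitarySegment

open Matrix

/-! ### Unitary diagonalization and its functional calculus. -/

section Diagonalization

variable {n : ℕ}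

/-- The matrix with eigenvalues `d` and the columns of `U` as eigenvectors. -/
def unitaryConj (U : Matrix (Fin n) (Fin n) ℂ) (d : Fin n → ℂ) : Matrix (Fin n) (Fin n) ℂ :=
  U * diagonal d * star U

theorem star_mul_of_mem {U : Matrix (Fin n) (Fin n) ℂ} (hU : U ∈ unitaryGroup (Fin n) ℂ) :
    star U * U = 1 := mem_unitaryGroup_iff'.1 hU

theorem mul_star_of_mem {U : Matrix (Fin n) (Fin n) ℂ} (hU : U ∈ unitaryGroup (Fin n) ℂ) :
    U * star U = 1 := mem_unitaryGroup_iff.1 hU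

theorem unitaryConj_mul {U : Matrix (Fin n) (Fin n) ℂ} (hU : U ∈ unitaryGroup (Fin n) ℂ)
    (d e : Fin n → ℂ) :
    unitaryConj U d * unitaryConj U e = unitaryConj U (fun k => d k * e k) := by
  have h : diagonal d * (star U * (U * (diagonal e * star U))) =
      diagonal (fun k => d k * e k) * star U := by
    rw [← Matrix.mul_assoc (star U) U, star_mul_of_mem hU, Matrix.one_mul,
      ← Matrix.mul_assoc, diagonal_mul_diagonal]
  simp only [unitaryConj, Matrix.mul_assoc, h]

theorem unitaryConj_one {U : Matrix (Fin n) (Fin n) ℂ} (hU : U ∈ unitaryGroup (Fin n) ℂ) :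
    unitaryConj U (fun _ => 1) = 1 := by
  simp [unitaryConj, diagonal_one, mul_star_of_mem hU]

theorem star_unitaryConj (U : Matrix (Fin n) (Fin n) ℂ) (d : Fin n → ℂ) :
    star (unitaryConj U d) = unitaryConj U (fun k => star (d k)) := by
  rw [unitaryConj, star_mul, star_mul, star_star, star_eq_conjTranspose (diagonal d),
    diagonal_conjTranspose, ← Matrix.mul_assoc]
  rfl

theorem unitaryConj_mem {U : Matrix (Fin n) (Fin n) ℂ} (hU : U ∈ unitaryGroup (Fin n) ℂ)
    {d : Fin n → ℂ} (hd : ∀ k, d k * star (d k) = 1) :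
    unitaryConj U d ∈ unitaryGroup (Fin n) ℂ := by
  rw [mem_unitaryGroup_iff, star_unitaryConj, unitaryConj_mul hU]
  simp only [hd]
  exact unitaryConj_one hU

theorem star_mul_unitaryConj_mul {U : Matrix (Fin n) (Fin n) ℂ}
    (hU : U ∈ unitaryGroup (Fin n) ℂ) (d : Fin n → ℂ) :
    star U * unitaryConj U d * U = diagonal d := by
  have : star U * unitaryConj U d * U = (star U * U) * diagonal d * (star U * U) := by
    simp only [unitaryConj, Matrix.mul_assoc]
  rw [this, star_mul_of_mem hU, Matrix.one_mul, Matrix.mul_one]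

theorem eq_unitaryConj_of_star_mul_mul {U A : Matrix (Fin n) (Fin n) ℂ}
    (hU : U ∈ unitaryGroup (Fin n) ℂ) {d : Fin n → ℂ} (h : star U * A * U = diagonal d) :
    A = unitaryConj U d := by
  have : A = (U * star U) * A * (U * star U) := by
    rw [mul_star_of_mem hU, Matrix.one_mul, Matrix.mul_one]
  rw [this, unitaryConj, ← h]
  simp only [Matrix.mul_assoc]

theorem eq_unitaryConj_of_mul_eq {U A : Matrix (Fin n) (Fin n) ℂ}
    (hU : U ∈ unitaryGroup (Fin n) ℂ) {d : Fin n → ℂ} (h : A * U = U * diagonal d) :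
    A = unitaryConj U d := by
  rw [unitaryConj, ← h, Matrix.mul_assoc, mul_star_of_mem hU, Matrix.mul_one]

theorem unitaryConj_conj (V U : Matrix (Fin n) (Fin n) ℂ) (d : Fin n → ℂ) :
    V * unitaryConj U d * star V = unitaryConj (V * U) d := by
  simp only [unitaryConj, Matrix.mul_assoc, star_mul]

theorem charpoly_unitaryConj {U : Matrix (Fin n) (Fin n) ℂ}
    (hU : U ∈ unitaryGroup (Fin n) ℂ) (d : Fin n → ℂ) :
    (unitaryConj U d).charpoly = ∏ k, (Polynomial.X - Polynomial.C (d k)) := by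
  rw [unitaryConj, charpoly_mul_comm, ← Matrix.mul_assoc, star_mul_of_mem hU, Matrix.one_mul,
    charpoly_diagonal]

theorem trace_unitaryConj {U : Matrix (Fin n) (Fin n) ℂ}
    (hU : U ∈ unitaryGroup (Fin n) ℂ) (d : Fin n → ℂ) :
    (unitaryConj U d).trace = ∑ k, d k := by
  rw [unitaryConj, trace_mul_comm, ← Matrix.mul_assoc, star_mul_of_mem hU, Matrix.one_mul,
    trace_diagonal]

theorem norm_unitaryConj {U : Matrix (Fin n) (Fin n) ℂ}
    (hU : U ∈ unitaryGroup (Fin n) ℂ) (d : Fin n → ℂ) : ‖unitaryConj U d‖ = ‖d‖ := by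
  rw [unitaryConj, CStarRing.norm_mul_mem_unitary _ (Unitary.star_mem hU),
    CStarRing.norm_mem_unitary_mul _ hU, l2_opNorm_diagonal]

theorem smul_unitaryConj (c : ℂ) (U : Matrix (Fin n) (Fin n) ℂ) (d : Fin n → ℂ) :
    c • unitaryConj U d = unitaryConj U (fun k => c * d k) := by
  have : diagonal (fun k => c * d k) = c • diagonal d := by
    rw [← diagonal_smul]; rfl
  rw [unitaryConj, unitaryConj, this, Matrix.mul_smul, Matrix.smul_mul]

theorem sub_unitaryConj (U : Matrix (Fin n) (Fin n) ℂ) (d e : Fin n → ℂ) :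
    unitaryConj U d - unitaryConj U e = unitaryConj U (fun k => d k - e k) := by
  rw [unitaryConj, unitaryConj, unitaryConj, ← Matrix.sub_mul, ← Matrix.mul_sub, diagonal_sub]

theorem add_unitaryConj (U : Matrix (Fin n) (Fin n) ℂ) (d e : Fin n → ℂ) :
    unitaryConj U d + unitaryConj U e = unitaryConj U (fun k => d k + e k) := by
  rw [unitaryConj, unitaryConj, unitaryConj, ← Matrix.add_mul, ← Matrix.mul_add, diagonal_add]

theorem exp_unitaryConj {U : Matrix (Fin n) (Fin n) ℂ}
    (hU : U ∈ unitaryGroup (Fin n) ℂ) (d : Fin n → ℂ) :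
    NormedSpace.exp (unitaryConj U d) = unitaryConj U (fun k => Complex.exp (d k)) := by
  have hinv : U⁻¹ = star U := inv_eq_right_inv (mul_star_of_mem hU)
  have hunit : IsUnit U := ⟨⟨U, star U, mul_star_of_mem hU, star_mul_of_mem hU⟩, rfl⟩
  rw [unitaryConj, unitaryConj, ← hinv, exp_conj U _ hunit, exp_diagonal]
  congr 3
  funext k
  rw [Pi.coe_exp, ← Complex.exp_eq_exp_ℂ]

/-- A permutation of the eigenvectors. -/
theorem exists_unitaryConj_comp_perm {U : Matrix (Fin n) (Fin n) ℂ}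
    (hU : U ∈ unitaryGroup (Fin n) ℂ) (σ : Equiv.Perm (Fin n)) :
    ∃ V ∈ unitaryGroup (Fin n) ℂ, ∀ d : Fin n → ℂ,
      unitaryConj U d = unitaryConj V (fun k => d (σ k)) := by
  have hsub : U.submatrix id σ ∈ unitaryGroup (Fin n) ℂ := by
    rw [mem_unitaryGroup_iff', star_eq_conjTranspose, conjTranspose_submatrix,
      ← submatrix_mul _ _ _ _ _ Function.bijective_id, ← star_eq_conjTranspose,
      star_mul_of_mem hU, submatrix_one_equiv]
  refine ⟨U.submatrix id σ, hsub, fun d => ?_⟩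
  ext i j
  rw [unitaryConj, unitaryConj, mul_apply, mul_apply]
  simp only [mul_diagonal, submatrix_apply, star_apply, id]
  exact (Equiv.sum_comp σ (fun k => U i k * d k * star (U j k))).symm

/-- Commuting symmetric operators split the space into orthogonal joint eigenspaces. A subordinate
orthonormal basis gives the columns of `U`, and self-adjointness makes the eigenvalues real. -/
theorem exists_joint_diagonalization {x y : Matrix (Fin n) (Fin n) ℂ}
    (hx : x.IsHermitian) (hy : y.IsHermitian) (hxy : Commute x y) :
    ∃ U ∈ unitaryGroup (Fin n) ℂ, ∃ a b : Fin n → ℝ,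
      x = unitaryConj U (fun k => (a k : ℂ)) ∧ y = unitaryConj U (fun k => (b k : ℂ)) := by
  classical
  have hA := isSymmetric_toEuclideanLin_iff.mpr hx
  have hB := isSymmetric_toEuclideanLin_iff.mpr hy
  have hAB : Commute (toEuclideanLin x) (toEuclideanLin y) := by
    ext v k
    simp only [Module.End.mul_apply, toLpLin_apply, mulVec_mulVec, hxy.eq]
  have hint := LinearMap.IsSymmetric.directSum_isInternal_of_commute hA hB hAB
  have horth := LinearMap.IsSymmetric.orthogonalFamily_eigenspace_inf_eigenspace hA hB
  -- The family is indexed by all of `ℂ × ℂ`. Only finitely many joint eigenspaces are nonzero, and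
  -- a subordinate basis needs a finite index type.
  have hfin := WellFoundedGT.finite_ne_bot_of_iSupIndep horth.independent
  have : Fintype {i // Module.End.eigenspace (toEuclideanLin x) (Prod.snd i) ⊓
    Module.End.eigenspace (toEuclideanLin y) i.1 ≠ ⊥} := hfin.fintype
  have hint' := DirectSum.isInternal_ne_bot_iff.2 hint
  have horth' := horth.comp (Subtype.val_injective (p := fun i : ℂ × ℂ =>
    Module.End.eigenspace (toEuclideanLin x) (Prod.snd i) ⊓
    Module.End.eigenspace (toEuclideanLin y) i.1 ≠ ⊥))
  have hn : Module.finrank ℂ (EuclideanSpace ℂ (Fin n)) = n := by simp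
  let e := hint'.subordinateOrthonormalBasis hn horth'
  let i := fun k => (hint'.subordinateOrthonormalBasisIndex hn k horth').1
  have he : ∀ k, e k ∈ Module.End.eigenspace (toEuclideanLin x) (i k).2 ⊓
      Module.End.eigenspace (toEuclideanLin y) (i k).1 := fun k =>
    hint'.subordinateOrthonormalBasis_subordinate hn k horth'
  let U : Matrix (Fin n) (Fin n) ℂ :=
    (EuclideanSpace.basisFun (Fin n) ℂ).toBasis.toMatrix e.toBasis
  have hU : U ∈ unitaryGroup (Fin n) ℂ :=
    (EuclideanSpace.basisFun (Fin n) ℂ).toMatrix_orthonormalBasis_mem_unitary e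
  have key : ∀ (A : Matrix (Fin n) (Fin n) ℂ) (d : Fin n → ℂ), A.IsHermitian →
      (∀ k, e k ∈ Module.End.eigenspace (toEuclideanLin A) (d k)) →
      ∃ a : Fin n → ℝ, A = unitaryConj U (fun k => (a k : ℂ)) := by
    intro A d hA hd
    have h1 : A = unitaryConj U d := by
      refine eq_unitaryConj_of_mul_eq hU ?_
      ext p q
      have := congrArg (fun v : EuclideanSpace ℂ (Fin n) => v p)
        (Module.End.mem_eigenspace_iff.1 (hd q))
      rw [mul_diagonal, mul_comm]
      exact this
    have h2 : diagonal d = diagonal (fun k => star (d k)) := by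
      rw [← star_mul_unitaryConj_mul hU, ← star_mul_unitaryConj_mul hU, ← star_unitaryConj, ← h1,
        star_eq_conjTranspose A, hA.eq]
    refine ⟨fun k => (d k).re, ?_⟩
    rw [h1]
    congr 1
    funext k
    have := congrFun (diagonal_injective h2) k
    exact (Complex.conj_eq_iff_re.1 this.symm).symm
  obtain ⟨a, ha⟩ := key x (fun k => (i k).2) hx fun k => (he k).1
  obtain ⟨b, hb⟩ := key y (fun k => (i k).1) hy fun k => (he k).2
  exact ⟨U, hU, a, b, ha, hb⟩

theorem exists_diagonalization {x : Matrix (Fin n) (Fin n) ℂ} (hx : x.IsHermitian) :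
    ∃ U ∈ unitaryGroup (Fin n) ℂ, ∃ a : Fin n → ℝ, x = unitaryConj U (fun k => (a k : ℂ)) := by
  obtain ⟨U, hU, a, -, ha, -⟩ := exists_joint_diagonalization hx hx (Commute.refl x)
  exact ⟨U, hU, a, ha⟩

end Diagonalization

/-! ### Doubly stochastic overlaps of orthonormal bases, and rearrangement. -/

section Overlap

variable {n : ℕ}

/-- The squared moduli of the inner products of the columns of `U` and of `V`. -/
def overlap (U V : Matrix (Fin n) (Fin n) ℂ) : Matrix (Fin n) (Fin n) ℝ :=
  Matrix.of fun k l => Complex.normSq ((star U * V) k l)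

/-- The rows and columns of the unitary matrix `star U * V` are unit vectors. -/
theorem overlap_mem_doublyStochastic {U V : Matrix (Fin n) (Fin n) ℂ}
    (hU : U ∈ unitaryGroup (Fin n) ℂ) (hV : V ∈ unitaryGroup (Fin n) ℂ) :
    overlap U V ∈ doublyStochastic ℝ (Fin n) := by
  have hW : star U * V ∈ unitaryGroup (Fin n) ℂ := mul_mem (Unitary.star_mem hU) hV
  rw [mem_doublyStochastic_iff_sum]
  refine ⟨fun k l => Complex.normSq_nonneg _, fun k => ?_, fun l => ?_⟩
  · have h := congrFun (congrFun (mul_star_of_mem hW) k) k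
    rw [mul_apply, one_apply_eq] at h
    have h' : ((∑ l, overlap U V k l : ℝ) : ℂ) = 1 := by
      rw [← h, Complex.ofReal_sum]
      exact Finset.sum_congr rfl fun l _ => (Complex.mul_conj _).symm
    exact_mod_cast h'
  · have h := congrFun (congrFun (star_mul_of_mem hW) l) l
    rw [mul_apply, one_apply_eq] at h
    have h' : ((∑ k, overlap U V k l : ℝ) : ℂ) = 1 := by
      rw [← h, Complex.ofReal_sum]
      refine Finset.sum_congr rfl fun k _ => ?_
      rw [overlap, of_apply, Complex.normSq_eq_conj_mul_self]
      rfl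
    exact_mod_cast h'

theorem star_mul_unitaryConj_mul_apply (U V : Matrix (Fin n) (Fin n) ℂ) (d : Fin n → ℂ)
    (k : Fin n) :
    (star U * unitaryConj V d * U) k k = ∑ l, (overlap U V k l : ℂ) * d l := by
  have : star U * unitaryConj V d * U = unitaryConj (star U * V) d := by
    rw [← unitaryConj_conj, star_star]
  rw [this, unitaryConj, mul_apply]
  refine Finset.sum_congr rfl fun l _ => ?_
  rw [mul_diagonal, overlap, of_apply, ← Complex.mul_conj, star_apply]
  simp only [RCLike.star_def]
  ring

theorem overlap_self {U : Matrix (Fin n) (Fin n) ℂ} (hU : U ∈ unitaryGroup (Fin n) ℂ) :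
    overlap U U = 1 := by
  ext k l
  rw [overlap, of_apply, star_mul_of_mem hU, one_apply, one_apply]
  split_ifs <;> simp

/-- For non-increasing `μ` and `β`, a doubly stochastic average of `β` does not increase its
pairing with `μ`. -/
theorem sum_mul_sum_le_of_mem_doublyStochastic {p : Matrix (Fin n) (Fin n) ℝ}
    (hp : p ∈ doublyStochastic ℝ (Fin n)) {μ β : Fin n → ℝ} (hμ : Antitone μ) (hβ : Antitone β) :
    ∑ k, μ k * ∑ l, p k l * β l ≤ ∑ k, μ k * β k := by
  -- By Birkhoff, `p` is a convex combination of permutation matrices. For each permutation the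
  -- claim is the rearrangement inequality.
  obtain ⟨w, hw0, hw1, rfl⟩ := exists_eq_sum_perm_of_mem_doublyStochastic hp
  have hmono : Monovary μ β := hμ.monovary hβ
  have hexp : ∑ k, μ k * ∑ l, (∑ σ, w σ • σ.permMatrix ℝ : Matrix _ _ ℝ) k l * β l =
      ∑ σ, w σ * ∑ k, μ k * β (σ k) := by
    have : ∀ k, ∑ l, (∑ σ, w σ • σ.permMatrix ℝ : Matrix _ _ ℝ) k l * β l =
        ∑ σ, w σ * β (σ k) := by
      intro k
      simp only [Matrix.sum_apply, Matrix.smul_apply, smul_eq_mul, Finset.sum_mul]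
      rw [Finset.sum_comm]
      refine Finset.sum_congr rfl fun σ _ => ?_
      simp [PEquiv.toMatrix_apply, Equiv.toPEquiv_apply]
    simp only [this, Finset.mul_sum]
    rw [Finset.sum_comm]
    refine Finset.sum_congr rfl fun σ _ => Finset.sum_congr rfl fun k _ => by ring
  rw [hexp]
  calc ∑ σ, w σ * ∑ k, μ k * β (σ k) ≤ ∑ σ, w σ * ∑ k, μ k * β k :=
        Finset.sum_le_sum fun σ _ =>
          mul_le_mul_of_nonneg_left hmono.sum_mul_comp_perm_le_sum_mul (hw0 σ)
    _ = ∑ k, μ k * β k := by rw [← Finset.sum_mul, hw1, one_mul]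

end Overlap

/-! ### Scalar trigonometric estimates. -/

section Scalar

theorem abs_sub_sin_le_sq (x : ℝ) : |x - Real.sin x| ≤ x ^ 2 := by
  wlog hx : 0 ≤ x generalizing x
  · have := this (-x) (by linarith)
    rwa [Real.sin_neg, neg_sq, ← abs_neg, show -(-x - -Real.sin x) = x - Real.sin x by ring] at this
  rw [abs_of_nonneg (by linarith [Real.sin_le hx])]
  rcases le_or_gt x 1 with h | h
  · rcases hx.eq_or_lt with rfl | hx'
    · simp
    have := Real.sin_gt_sub_cube hx'
    nlinarith [sq_nonneg x]
  · rcases le_or_gt x 2 with h2 | h2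
    · have := Real.sin_nonneg_of_nonneg_of_le_pi hx (by linarith [Real.pi_gt_three])
      nlinarith
    · nlinarith [Real.neg_one_le_sin x]

theorem one_sub_cos_le_sq (x : ℝ) : 1 - Real.cos x ≤ x ^ 2 := by
  nlinarith [Real.one_sub_sq_div_two_le_cos (x := x), sq_nonneg x]

/-- On an interval that stays away from `± 2π`, the deviation of `sin` from the identity is bounded
by a multiple of `1 - cos`. -/
theorem exists_abs_sub_sin_le {α : ℝ} (hα : α < Real.pi) :
    ∃ K : ℝ, 0 ≤ K ∧ ∀ x : ℝ, |x| ≤ 2 * α → |x - Real.sin x| ≤ K * (1 - Real.cos x) := by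
  rcases le_or_gt α 0 with h0 | h0
  · refine ⟨0, le_rfl, fun x hx => ?_⟩
    have : x = 0 := abs_eq_zero.1 (le_antisymm (by linarith) (abs_nonneg x))
    simp [this]
  have hs : 0 < Real.sin α := Real.sin_pos_of_pos_of_lt_pi h0 hα
  -- Concavity of `sin` on `[0, π]` gives `|sin (x/2)| ≥ |x/2| sin α / α`. Inserting this in `1 -
  -- cos x = 2 sin² (x/2)` bounds `x²`, hence `|x - sin x|`, with this constant.
  refine ⟨2 * (α / Real.sin α) ^ 2, by positivity, fun x hx => ?_⟩
  have key : |x / 2| * (Real.sin α / α) ≤ |Real.sin (x / 2)| := by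
    set y := |x / 2| with hy
    have hy0 : 0 ≤ y := abs_nonneg _
    have hyα : y ≤ α := by rw [hy, abs_div, abs_two]; linarith
    have h1 : |Real.sin (x / 2)| = Real.sin y := by
      rw [← Real.abs_sin_eq_sin_abs_of_abs_le_pi (by rw [← hy]; linarith)]
    have hc := strictConcaveOn_sin_Icc.concaveOn.2
      (show (0 : ℝ) ∈ Set.Icc 0 Real.pi from ⟨le_rfl, Real.pi_pos.le⟩)
      (show α ∈ Set.Icc 0 Real.pi from ⟨h0.le, hα.le⟩)
      (show 0 ≤ 1 - y / α by rw [sub_nonneg, div_le_one h0]; exact hyα)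
      (show 0 ≤ y / α by positivity) (by ring)
    simp only [smul_eq_mul, mul_zero, Real.sin_zero, zero_add] at hc
    rw [div_mul_cancel₀ _ h0.ne'] at hc
    rw [h1]
    calc y * (Real.sin α / α) = y / α * Real.sin α := by ring
      _ ≤ _ := hc
  have hcos : 1 - Real.cos x = 2 * Real.sin (x / 2) ^ 2 := by
    have := Real.cos_sq' (x / 2)
    have h2 := Real.cos_two_mul (x / 2)
    rw [mul_div_cancel₀ x two_ne_zero] at h2
    linarith
  have hsq : (x / 2) ^ 2 * (Real.sin α / α) ^ 2 ≤ Real.sin (x / 2) ^ 2 := by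
    rw [← sq_abs (x / 2), ← sq_abs (Real.sin (x / 2)), ← mul_pow]
    exact pow_le_pow_left₀ (by positivity) key 2
  have hone : (α / Real.sin α) ^ 2 * (Real.sin α / α) ^ 2 = 1 := by
    field_simp
  calc |x - Real.sin x| ≤ x ^ 2 := abs_sub_sin_le_sq x
    _ = 4 * ((α / Real.sin α) ^ 2 * ((x / 2) ^ 2 * (Real.sin α / α) ^ 2)) := by
        linear_combination (-x ^ 2) * hone
    _ ≤ 4 * ((α / Real.sin α) ^ 2 * Real.sin (x / 2) ^ 2) := by gcongr
    _ = 2 * (α / Real.sin α) ^ 2 * (1 - Real.cos x) := by rw [hcos]; ring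

end Scalar

/-! ### First-order estimate for the angles of a perturbed unitary matrix. -/

section Expansion

variable {n : ℕ}

/-- The unitary matrix with arguments of eigenvalues `θ` and the columns of `U` as eigenvectors. -/
noncomputable def angleConj (U : Matrix (Fin n) (Fin n) ℂ) (θ : Fin n → ℝ) : Matrix (Fin n) (Fin n) ℂ :=
  unitaryConj U fun k => Complex.exp ((θ k : ℂ) * Complex.I)

/-- This compares the `k`-th diagonal entries, in the basis `U`, of both sides of `h`. There the
right factor is diagonal, and its phase is moved to the left-hand side. -/
theorem sum_overlap_mul_exp_eq {U V T : Matrix (Fin n) (Fin n) ℂ}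
    (hU : U ∈ unitaryGroup (Fin n) ℂ) {θ θ' β : Fin n → ℝ}
    (h : angleConj V θ' = angleConj T β * angleConj U θ) (k : Fin n) :
    ∑ l, (overlap U V k l : ℂ) * Complex.exp (((θ' l - θ k : ℝ) : ℂ) * Complex.I) =
      ∑ j, (overlap U T k j : ℂ) * Complex.exp ((β j : ℂ) * Complex.I) := by
  have h1 : star U * angleConj V θ' * U =
      (star U * angleConj T β * U) * diagonal fun k => Complex.exp ((θ k : ℂ) * Complex.I) := by
    rw [← star_mul_unitaryConj_mul hU, h]
    have : star U * angleConj T β * U * (star U * angleConj U θ * U) =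
        star U * angleConj T β * (U * star U) * angleConj U θ * U := by
      simp only [Matrix.mul_assoc]
    rw [← angleConj, this, mul_star_of_mem hU, Matrix.mul_one]
    simp only [Matrix.mul_assoc]
  have h2 := congrFun (congrFun h1 k) k
  rw [mul_diagonal, angleConj, angleConj, star_mul_unitaryConj_mul_apply,
    star_mul_unitaryConj_mul_apply] at h2
  have h3 : ∀ l, Complex.exp (((θ' l - θ k : ℝ) : ℂ) * Complex.I) =
      Complex.exp ((θ' l : ℂ) * Complex.I) * Complex.exp (-((θ k : ℂ) * Complex.I)) := by
    intro l
    rw [← Complex.exp_add]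
    congr 1
    push_cast
    ring
  simp only [h3, ← mul_assoc]
  rw [← Finset.sum_mul, h2, mul_assoc, ← Complex.exp_add, add_neg_cancel, Complex.exp_zero,
    mul_one]

/-- Real parts of the diagonal identity make the average of `1 - cos (θ' l - θ k)` quadratic in `s`.
Through `hK` this controls the error in replacing `sin` by the identity in the imaginary parts. -/
theorem abs_sum_overlap_sub_le {U V T : Matrix (Fin n) (Fin n) ℂ}
    (hU : U ∈ unitaryGroup (Fin n) ℂ) (hV : V ∈ unitaryGroup (Fin n) ℂ)
    (hT : T ∈ unitaryGroup (Fin n) ℂ) {θ θ' β : Fin n → ℝ} {s B K α : ℝ}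
    (h : angleConj V θ' = angleConj T (fun j => s * β j) * angleConj U θ) (hK0 : 0 ≤ K)
    (hK : ∀ x : ℝ, |x| ≤ 2 * α → |x - Real.sin x| ≤ K * (1 - Real.cos x))
    (hβ : ∀ j, |β j| ≤ B) (hθ : ∀ k, |θ k| ≤ α) (hθ' : ∀ k, |θ' k| ≤ α) (k : Fin n) :
    |∑ l, overlap U V k l * θ' l - θ k - s * ∑ j, overlap U T k j * β j| ≤
      (K + 1) * B ^ 2 * s ^ 2 := by
  have hp := overlap_mem_doublyStochastic hU hV
  have hq := overlap_mem_doublyStochastic hU hT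
  have hp1 := sum_row_of_mem_doublyStochastic hp k
  have hq1 := sum_row_of_mem_doublyStochastic hq k
  have heq := sum_overlap_mul_exp_eq hU h k
  have hre : ∑ l, overlap U V k l * Real.cos (θ' l - θ k) =
      ∑ j, overlap U T k j * Real.cos (s * β j) := by
    have := congrArg Complex.re heq
    simpa only [Complex.re_sum, Complex.re_ofReal_mul, Complex.exp_ofReal_mul_I_re] using this
  have him : ∑ l, overlap U V k l * Real.sin (θ' l - θ k) =
      ∑ j, overlap U T k j * Real.sin (s * β j) := by
    have := congrArg Complex.im heq
    simpa only [Complex.im_sum, Complex.im_ofReal_mul, Complex.exp_ofReal_mul_I_im] using this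
  have hsq : ∀ j, (s * β j) ^ 2 ≤ B ^ 2 * s ^ 2 := fun j => by
    have : β j ^ 2 ≤ B ^ 2 := sq_le_sq' (abs_le.1 (hβ j)).1 (abs_le.1 (hβ j)).2
    rw [mul_pow, mul_comm]
    gcongr
  have hcos : ∑ l, overlap U V k l * (1 - Real.cos (θ' l - θ k)) ≤ B ^ 2 * s ^ 2 := by
    have e1 : ∑ l, overlap U V k l * (1 - Real.cos (θ' l - θ k)) =
        ∑ j, overlap U T k j * (1 - Real.cos (s * β j)) := by
      simp only [mul_sub, mul_one, Finset.sum_sub_distrib, hre, hp1, hq1]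
    rw [e1]
    calc ∑ j, overlap U T k j * (1 - Real.cos (s * β j))
        ≤ ∑ j, overlap U T k j * (B ^ 2 * s ^ 2) := Finset.sum_le_sum fun j _ =>
          mul_le_mul_of_nonneg_left ((one_sub_cos_le_sq _).trans (hsq j))
            (nonneg_of_mem_doublyStochastic hq)
      _ = B ^ 2 * s ^ 2 := by rw [← Finset.sum_mul, hq1, one_mul]
  have hdecomp : ∑ l, overlap U V k l * θ' l - θ k - s * ∑ j, overlap U T k j * β j =
      ∑ l, overlap U V k l * ((θ' l - θ k) - Real.sin (θ' l - θ k)) -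
        ∑ j, overlap U T k j * (s * β j - Real.sin (s * β j)) := by
    simp only [mul_sub, Finset.sum_sub_distrib, him, ← Finset.sum_mul, hp1, one_mul,
      Finset.mul_sum]
    have : ∀ j, overlap U T k j * (s * β j) = s * (overlap U T k j * β j) := fun j => by ring
    simp only [this]
    ring
  have b1 : |∑ l, overlap U V k l * ((θ' l - θ k) - Real.sin (θ' l - θ k))| ≤
      K * (B ^ 2 * s ^ 2) := by
    calc _ ≤ ∑ l, |overlap U V k l * ((θ' l - θ k) - Real.sin (θ' l - θ k))| :=
          Finset.abs_sum_le_sum_abs _ _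
      _ ≤ ∑ l, K * (overlap U V k l * (1 - Real.cos (θ' l - θ k))) := by
          refine Finset.sum_le_sum fun l _ => ?_
          have hpos : 0 ≤ overlap U V k l := nonneg_of_mem_doublyStochastic hp
          rw [abs_mul, abs_of_nonneg hpos, mul_left_comm K]
          refine mul_le_mul_of_nonneg_left (hK _ ?_) hpos
          calc |θ' l - θ k| ≤ |θ' l| + |θ k| := abs_sub _ _
            _ ≤ 2 * α := by linarith [hθ k, hθ' l]
      _ ≤ K * (B ^ 2 * s ^ 2) := by
          rw [← Finset.mul_sum]
          exact mul_le_mul_of_nonneg_left hcos hK0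
  have b2 : |∑ j, overlap U T k j * (s * β j - Real.sin (s * β j))| ≤ B ^ 2 * s ^ 2 := by
    calc _ ≤ ∑ j, |overlap U T k j * (s * β j - Real.sin (s * β j))| :=
          Finset.abs_sum_le_sum_abs _ _
      _ ≤ ∑ j, overlap U T k j * (B ^ 2 * s ^ 2) := by
          refine Finset.sum_le_sum fun j _ => ?_
          have hpos : 0 ≤ overlap U T k j := nonneg_of_mem_doublyStochastic hq
          rw [abs_mul, abs_of_nonneg hpos]
          exact mul_le_mul_of_nonneg_left ((abs_sub_sin_le_sq _).trans (hsq j)) hpos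
      _ = B ^ 2 * s ^ 2 := by rw [← Finset.sum_mul, hq1, one_mul]
  rw [hdecomp]
  refine (abs_sub _ _).trans ?_
  linarith

/-- First-order lower bound for the weighted sum of the arguments of the eigenvalues under
multiplication by a unitary matrix near the identity. -/
theorem sum_mul_add_le_of_angleConj_eq_mul {U V T : Matrix (Fin n) (Fin n) ℂ}
    (hU : U ∈ unitaryGroup (Fin n) ℂ) (hV : V ∈ unitaryGroup (Fin n) ℂ)
    (hT : T ∈ unitaryGroup (Fin n) ℂ) {θ θ' β μ : Fin n → ℝ} {s B K α : ℝ}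
    (h : angleConj V θ' = angleConj T (fun j => s * β j) * angleConj U θ) (hK0 : 0 ≤ K)
    (hK : ∀ x : ℝ, |x| ≤ 2 * α → |x - Real.sin x| ≤ K * (1 - Real.cos x))
    (hβ : ∀ j, |β j| ≤ B) (hθ : ∀ k, |θ k| ≤ α) (hθ' : ∀ k, |θ' k| ≤ α)
    (hμ : Antitone μ) (hanti : Antitone θ') :
    ∑ k, μ k * θ k + s * ∑ k, μ k * ∑ j, overlap U T k j * β j -
      (∑ k, |μ k|) * ((K + 1) * B ^ 2) * s ^ 2 ≤ ∑ k, μ k * θ' k := by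
  -- Since `θ'` is non-increasing, it suffices to bound from below the pairing of `μ` with the
  -- averages of `θ'`, which are known up to `O(s²)`.
  refine le_trans ?_ (sum_mul_sum_le_of_mem_doublyStochastic
    (overlap_mem_doublyStochastic hU hV) hμ hanti)
  rw [← sub_nonneg]
  have : ∑ k, μ k * ∑ l, overlap U V k l * θ' l - (∑ k, μ k * θ k +
      s * ∑ k, μ k * ∑ j, overlap U T k j * β j -
        (∑ k, |μ k|) * ((K + 1) * B ^ 2) * s ^ 2) =
      ∑ k, (μ k * (∑ l, overlap U V k l * θ' l - θ k - s * ∑ j, overlap U T k j * β j) +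
        |μ k| * ((K + 1) * B ^ 2 * s ^ 2)) := by
    have hs : s * ∑ k, μ k * ∑ j, overlap U T k j * β j =
        ∑ k, μ k * (s * ∑ j, overlap U T k j * β j) := by
      rw [Finset.mul_sum]
      exact Finset.sum_congr rfl fun k _ => by ring
    rw [hs, Finset.sum_add_distrib, ← Finset.sum_mul]
    simp only [mul_sub, Finset.sum_sub_distrib]
    ring
  rw [this]
  refine Finset.sum_nonneg fun k _ => ?_
  have h1 := abs_sum_overlap_sub_le hU hV hT h hK0 hK hβ hθ hθ' k
  have h2 := mul_le_mul_of_nonneg_left h1 (abs_nonneg (μ k))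
  rw [← abs_mul] at h2
  linarith [neg_abs_le (μ k * (∑ l, overlap U V k l * θ' l - θ k -
    s * ∑ j, overlap U T k j * β j))]

end Expansion

/-! ### Spectral theorem for unitary matrices and comparison of eigenangles. -/

section Angles

variable {n : ℕ}

theorem exp_mul_I_mul_star (r : ℝ) :
    Complex.exp ((r : ℂ) * Complex.I) * star (Complex.exp ((r : ℂ) * Complex.I)) = 1 := by
  rw [RCLike.star_def, Complex.mul_conj, Complex.normSq_eq_norm_sq, Complex.norm_exp_ofReal_mul_I]
  norm_num

theorem angleConj_mem {U : Matrix (Fin n) (Fin n) ℂ} (hU : U ∈ unitaryGroup (Fin n) ℂ)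
    (θ : Fin n → ℝ) : angleConj U θ ∈ unitaryGroup (Fin n) ℂ :=
  unitaryConj_mem hU fun k => exp_mul_I_mul_star (θ k)

theorem angleConj_mul {U : Matrix (Fin n) (Fin n) ℂ} (hU : U ∈ unitaryGroup (Fin n) ℂ)
    (θ φ : Fin n → ℝ) :
    angleConj U θ * angleConj U φ = angleConj U (fun k => θ k + φ k) := by
  rw [angleConj, angleConj, unitaryConj_mul hU, angleConj]
  congr 1
  funext k
  rw [← Complex.exp_add]
  push_cast
  ring_nf

theorem angleConj_zero {U : Matrix (Fin n) (Fin n) ℂ} (hU : U ∈ unitaryGroup (Fin n) ℂ) :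
    angleConj U (fun _ => 0) = 1 := by
  simp [angleConj, unitaryConj_one hU]

theorem exp_I_smul_unitaryConj {U : Matrix (Fin n) (Fin n) ℂ}
    (hU : U ∈ unitaryGroup (Fin n) ℂ) (a : Fin n → ℝ) (t : ℝ) :
    NormedSpace.exp ((Complex.I * (t : ℂ)) • unitaryConj U fun k => (a k : ℂ)) =
      angleConj U fun k => t * a k := by
  rw [smul_unitaryConj, exp_unitaryConj hU, angleConj]
  congr 1
  funext k
  push_cast
  ring_nf

theorem exp_I_smul_unitaryConj_one {U : Matrix (Fin n) (Fin n) ℂ}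
    (hU : U ∈ unitaryGroup (Fin n) ℂ) (a : Fin n → ℝ) :
    NormedSpace.exp (Complex.I • unitaryConj U fun k => (a k : ℂ)) = angleConj U a := by
  simpa using exp_I_smul_unitaryConj hU a 1

theorem exists_antitone_comp_perm (θ : Fin n → ℝ) :
    ∃ σ : Equiv.Perm (Fin n), Antitone fun k => θ (σ k) := by
  refine ⟨Tuple.sort fun k => -θ k, fun i j hij => ?_⟩
  have := Tuple.monotone_sort (fun k => -θ k) hij
  simpa using this

theorem exists_angleConj_comp_perm {U : Matrix (Fin n) (Fin n) ℂ}
    (hU : U ∈ unitaryGroup (Fin n) ℂ) (θ : Fin n → ℝ) (σ : Equiv.Perm (Fin n)) :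
    ∃ V ∈ unitaryGroup (Fin n) ℂ, angleConj U θ = angleConj V fun k => θ (σ k) := by
  obtain ⟨V, hV, h⟩ := exists_unitaryConj_comp_perm hU σ
  exact ⟨V, hV, h _⟩

/-- Spectral theorem for unitary matrices. -/
theorem exists_eq_angleConj {W : Matrix (Fin n) (Fin n) ℂ} (hW : W ∈ unitaryGroup (Fin n) ℂ) :
    ∃ U ∈ unitaryGroup (Fin n) ℂ, ∃ θ : Fin n → ℝ, Antitone θ ∧ (∀ k, |θ k| ≤ Real.pi) ∧
      W = angleConj U θ := by
  -- `W` is normal, so its Hermitian real and imaginary parts commute and are diagonalized together.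
  have hc : Commute W (star W) := by
    rw [commute_iff_eq, star_mul_of_mem hW, mul_star_of_mem hW]
  have hC : (((1 / 2 : ℂ)) • (W + star W)).IsHermitian := by
    rw [IsHermitian, ← star_eq_conjTranspose, star_smul, star_add, star_star, add_comm]
    norm_num
  have hS : ((-Complex.I / 2) • (W - star W)).IsHermitian := by
    rw [IsHermitian, ← star_eq_conjTranspose, star_smul, star_sub, star_star, ← neg_sub W,
      smul_neg, ← neg_smul]
    congr 1
    simp
    ring
  have hCS : Commute (((1 / 2 : ℂ)) • (W + star W)) ((-Complex.I / 2) • (W - star W)) := by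
    refine Commute.smul_left (Commute.smul_right ?_ _) _
    exact ((Commute.refl W).sub_right hc).add_left (hc.symm.sub_right (Commute.refl _))
  obtain ⟨U, hU, a, b, ha, hb⟩ := exists_joint_diagonalization hC hS hCS
  have hWd : W = unitaryConj U fun k => (a k : ℂ) + Complex.I * b k := by
    rw [← add_unitaryConj, ← smul_unitaryConj, ← ha, ← hb, smul_smul, smul_add, smul_sub]
    have : Complex.I * (-Complex.I / 2) = 1 / 2 := by
      rw [mul_div_assoc', mul_neg, Complex.I_mul_I, neg_neg]
    rw [this, add_add_sub_cancel, ← add_smul]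
    norm_num
  have hnorm : ∀ k, ‖(a k : ℂ) + Complex.I * b k‖ = 1 := by
    intro k
    have h1 := mul_star_of_mem hW
    rw [hWd, star_unitaryConj, unitaryConj_mul hU] at h1
    have h2 : diagonal (fun k => ((a k : ℂ) + Complex.I * b k) *
        star ((a k : ℂ) + Complex.I * b k)) = 1 := by
      rw [← star_mul_unitaryConj_mul hU, h1, Matrix.mul_one, star_mul_of_mem hU]
    have h3 := congrFun (congrFun h2 k) k
    rw [diagonal_apply_eq, one_apply_eq, RCLike.star_def, Complex.mul_conj,
      Complex.normSq_eq_norm_sq] at h3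
    have h4 : ‖(a k : ℂ) + Complex.I * b k‖ ^ 2 = 1 := by exact_mod_cast h3
    exact (pow_eq_one_iff_of_nonneg (norm_nonneg _) two_ne_zero).1 h4
  have hWθ : W = angleConj U fun k => ((a k : ℂ) + Complex.I * b k).arg := by
    rw [hWd, angleConj]
    congr 1
    funext k
    have := Complex.norm_mul_exp_arg_mul_I ((a k : ℂ) + Complex.I * b k)
    rw [hnorm k, Complex.ofReal_one, one_mul] at this
    exact this.symm
  obtain ⟨σ, hσ⟩ := exists_antitone_comp_perm fun k => ((a k : ℂ) + Complex.I * b k).arg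
  obtain ⟨V, hV, hVU⟩ := exists_angleConj_comp_perm hU
    (fun k => ((a k : ℂ) + Complex.I * b k).arg) σ
  exact ⟨V, hV, _, hσ, fun k => Complex.abs_arg_le_pi _, hWθ.trans hVU⟩

/-- Equal root multisets give fibres of equal cardinality over each value. Bijections of the fibres
glue to a permutation. -/
theorem exists_perm_of_prod_X_sub_C_eq {f g : Fin n → ℂ}
    (h : ∏ k, (Polynomial.X - Polynomial.C (f k)) = ∏ k, (Polynomial.X - Polynomial.C (g k))) :
    ∃ σ : Equiv.Perm (Fin n), ∀ k, f k = g (σ k) := by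
  have hroots : ∀ f : Fin n → ℂ, (∏ k, (Polynomial.X - Polynomial.C (f k))).roots =
      Finset.univ.val.map f := by
    intro f
    have := Polynomial.roots_multiset_prod_X_sub_C (Finset.univ.val.map f)
    rwa [Multiset.map_map] at this
  have hm : Finset.univ.val.map f = Finset.univ.val.map g := by rw [← hroots, ← hroots, h]
  have hcard : ∀ c, Nonempty ({k // f k = c} ≃ {k // g k = c}) := by
    intro c
    rw [← Fintype.card_eq]
    have := congrArg (Multiset.count c) hm
    rw [Multiset.count_map, Multiset.count_map] at this
    rw [Fintype.card_subtype, Fintype.card_subtype]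
    simpa only [eq_comm, Finset.card_def, Finset.filter_val] using this
  exact ⟨Equiv.ofFiberEquiv fun c => (hcard c).some,
    fun k => (Equiv.ofFiberEquiv_map (fun c => (hcard c).some) k).symm⟩

theorem exp_mul_I_injOn {a b : ℝ} (ha : |a| < Real.pi) (hb : |b| < Real.pi)
    (h : Complex.exp ((a : ℂ) * Complex.I) = Complex.exp ((b : ℂ) * Complex.I)) : a = b := by
  have key : ∀ r : ℝ, |r| < Real.pi → (Complex.exp ((r : ℂ) * Complex.I)).arg = r := fun r hr => by
    rw [Complex.arg_exp_mul_I]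
    exact (toIocMod_eq_self _).2 ⟨(abs_lt.1 hr).1, by linarith [(abs_lt.1 hr).2]⟩
  rw [← key a ha, ← key b hb, h]

/-- The eigenangles of a diagonalized unitary matrix are its list of angles, rearranged. -/
theorem IsEigenangles.exists_perm {U : Matrix (Fin n) (Fin n) ℂ}
    (hU : U ∈ unitaryGroup (Fin n) ℂ) {φ θ : Fin n → ℝ} (h : IsEigenangles (angleConj U φ) θ) :
    ∃ σ : Equiv.Perm (Fin n), ∀ k, Complex.exp ((θ k : ℂ) * Complex.I) =
      Complex.exp ((φ (σ k) : ℂ) * Complex.I) := by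
  have h1 := h.charpoly_eq
  rw [angleConj, charpoly_unitaryConj hU] at h1
  exact exists_perm_of_prod_X_sub_C_eq h1.symm

theorem IsEigenangles.exists_perm_eq {U : Matrix (Fin n) (Fin n) ℂ}
    (hU : U ∈ unitaryGroup (Fin n) ℂ) {φ θ : Fin n → ℝ} (hφ : ∀ k, |φ k| < Real.pi)
    (h : IsEigenangles (angleConj U φ) θ) :
    ∃ σ : Equiv.Perm (Fin n), ∀ k, θ k = φ (σ k) := by
  obtain ⟨σ, hσ⟩ := h.exists_perm hU
  exact ⟨σ, fun k => exp_mul_I_injOn (abs_lt.2 (h.mem_Ioo k)) (hφ _) (hσ k)⟩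

theorem IsEigenangles.exists_eq_angleConj {W : Matrix (Fin n) (Fin n) ℂ} {θ : Fin n → ℝ}
    (h : IsEigenangles W θ) (hW : W ∈ unitaryGroup (Fin n) ℂ) :
    ∃ U ∈ unitaryGroup (Fin n) ℂ, W = angleConj U θ := by
  obtain ⟨U, hU, φ, -, -, rfl⟩ := UnitarySegment.exists_eq_angleConj hW
  obtain ⟨σ, hσ⟩ := h.exists_perm hU
  obtain ⟨V, hV, hVU⟩ := exists_angleConj_comp_perm hU φ σ
  refine ⟨V, hV, hVU.trans ?_⟩
  rw [angleConj, angleConj]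
  congr 1
  funext k
  exact (hσ k).symm

end Angles

/-! ### Subadditivity of the weighted angle sum on products. -/

section Product

variable {n : ℕ}

/-- If `φ k` were larger, every `α l - φ k` would have non-positive cosine, whereas the diagonal
identity equates their average with an average of `cos (β j) ≥ cos M > 0`. The bound keeps
differences of product angles uniformly away from `±2π`. -/
theorem abs_angle_le_of_angleConj_mul {U V T : Matrix (Fin n) (Fin n) ℂ}
    (hU : U ∈ unitaryGroup (Fin n) ℂ) (hV : V ∈ unitaryGroup (Fin n) ℂ)
    (hT : T ∈ unitaryGroup (Fin n) ℂ) {α β φ : Fin n → ℝ} {M : ℝ} (hM : M < Real.pi / 2)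
    (hα : ∀ k, |α k| ≤ M) (hβ : ∀ k, |β k| ≤ M) (hφ : ∀ k, |φ k| ≤ Real.pi)
    (h : angleConj V φ = angleConj T β * angleConj U α) (k : Fin n) :
    |φ k| ≤ Real.pi / 2 + M := by
  by_contra! hcon
  have h' : angleConj U α = angleConj T (fun j => -β j) * angleConj V φ := by
    rw [h, ← Matrix.mul_assoc, angleConj_mul hT]
    simp only [neg_add_cancel, angleConj_zero hT, Matrix.one_mul]
  have heq := congrArg Complex.re (sum_overlap_mul_exp_eq hV h' k)
  simp only [Complex.re_sum, Complex.re_ofReal_mul, Complex.exp_ofReal_mul_I_re] at heq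
  have hp := overlap_mem_doublyStochastic hV hU
  have hq := overlap_mem_doublyStochastic hV hT
  have h1 : ∑ l, overlap V U k l * Real.cos (α l - φ k) ≤ 0 := by
    refine Finset.sum_nonpos fun l _ =>
      mul_nonpos_of_nonneg_of_nonpos (nonneg_of_mem_doublyStochastic hp) ?_
    have hl := abs_le.1 (hα l)
    have hk := abs_le.1 (hφ k)
    rcases lt_abs.1 hcon with hpos | hneg
    · rw [← Real.cos_neg]
      exact Real.cos_nonpos_of_pi_div_two_le_of_le (by linarith) (by linarith)
    · exact Real.cos_nonpos_of_pi_div_two_le_of_le (by linarith) (by linarith)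
  have hMpos : 0 < Real.cos M := Real.cos_pos_of_mem_Ioo
    ⟨by linarith [(abs_nonneg _).trans (hα k), Real.pi_pos], hM⟩
  have h2 : Real.cos M ≤ ∑ j, overlap V T k j * Real.cos (-β j) := by
    calc Real.cos M = ∑ j, overlap V T k j * Real.cos M := by
          rw [← Finset.sum_mul, sum_row_of_mem_doublyStochastic hq, one_mul]
      _ ≤ _ := by
        refine Finset.sum_le_sum fun j _ =>
          mul_le_mul_of_nonneg_left ?_ (nonneg_of_mem_doublyStochastic hq)
        rw [Real.cos_neg, ← Real.cos_abs (β j)]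
        exact Real.cos_le_cos_of_nonneg_of_le_pi (abs_nonneg _)
          (by linarith [Real.pi_pos]) (hβ j)
  linarith

theorem exists_bound_of_abs_lt {a : ℝ} (ha : 0 < a) {θ : Fin n → ℝ} (h : ∀ k, |θ k| < a) :
    ∃ M, 0 ≤ M ∧ M < a ∧ ∀ k, |θ k| ≤ M :=
  ⟨‖θ‖, norm_nonneg _, (pi_norm_lt_iff ha).2 h, fun k => norm_le_pi_norm θ k⟩

/-- The weighted sum of the arguments of the eigenvalues is subadditive on products of two unitary
matrices whose spectra lie in the open right half-plane. -/
theorem sum_mul_le_of_angleConj_eq_mul {U V T : Matrix (Fin n) (Fin n) ℂ}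
    (hU : U ∈ unitaryGroup (Fin n) ℂ) (hV : V ∈ unitaryGroup (Fin n) ℂ)
    (hT : T ∈ unitaryGroup (Fin n) ℂ) {α β γ μ : Fin n → ℝ}
    (hα : ∀ k, |α k| < Real.pi / 2) (hβ : ∀ k, |β k| < Real.pi / 2) (hγ : ∀ k, |γ k| ≤ Real.pi)
    (hα' : Antitone α) (hβ' : Antitone β) (hμ : Antitone μ)
    (h : angleConj V γ = angleConj T β * angleConj U α) :
    ∑ k, μ k * γ k ≤ ∑ k, μ k * α k + ∑ k, μ k * β k := by
  obtain ⟨M₁, h10, h1, hα1⟩ := exists_bound_of_abs_lt Real.pi_div_two_pos hα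
  obtain ⟨M₂, h20, h2, hβ2⟩ := exists_bound_of_abs_lt Real.pi_div_two_pos hβ
  set M := max M₁ M₂ with hMdef
  have hM0 : 0 ≤ M := h10.trans (le_max_left _ _)
  have hM : M < Real.pi / 2 := max_lt h1 h2
  have hαM : ∀ k, |α k| ≤ M := fun k => (hα1 k).trans (le_max_left _ _)
  have hβM : ∀ k, |β k| ≤ M := fun k => (hβ2 k).trans (le_max_right _ _)
  obtain ⟨K, hK0, hK⟩ := exists_abs_sub_sin_le (α := Real.pi / 2 + M) (by linarith)
  set C := (∑ k, |μ k|) * ((K + 1) * M ^ 2) with hC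
  have hC0 : 0 ≤ C := mul_nonneg (Finset.sum_nonneg fun _ _ => abs_nonneg _) (by positivity)
  -- The left factor is removed in `N` equal steps: `j = 0` is the full product and `j = N` leaves
  -- only `angleConj U α`. Each step costs at most `(1/N) ∑ μ β + C/N²`, so the total error `C/N`
  -- vanishes in the limit.
  have main : ∀ N : ℕ, 0 < N → ∀ j : ℕ, j ≤ N → ∀ (Z : Matrix (Fin n) (Fin n) ℂ) (θ : Fin n → ℝ),
      Z ∈ unitaryGroup (Fin n) ℂ → Antitone θ → (∀ k, |θ k| ≤ Real.pi) →
      angleConj Z θ = angleConj T (fun k => (1 - (j : ℝ) / N) * β k) * angleConj U α →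
      ∑ k, μ k * γ k ≤ ∑ k, μ k * θ k + j * ((1 / N) * ∑ k, μ k * β k + C * (1 / N) ^ 2) := by
    intro N hN j
    have hN' : (0 : ℝ) < N := by exact_mod_cast hN
    have hbd : ∀ j : ℕ, j ≤ N → ∀ k, |(1 - (j : ℝ) / N) * β k| ≤ M := by
      intro j hj k
      have h1 : (j : ℝ) / N ≤ 1 := by
        rw [div_le_one hN']
        exact_mod_cast hj
      have h0 : 0 ≤ (j : ℝ) / N := by positivity
      rw [abs_mul, abs_of_nonneg (by linarith)]
      calc (1 - (j : ℝ) / N) * |β k| ≤ 1 * M := by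
            gcongr
            · linarith
            · exact hβM k
        _ = M := one_mul M
    induction j with
    | zero =>
      intro _ Z θ hZ hθ hθpi hZeq
      have hb := abs_angle_le_of_angleConj_mul hU hZ hT hM hαM (hbd 0 (Nat.zero_le _)) hθpi hZeq
      have hb' := abs_angle_le_of_angleConj_mul hU hV hT hM hαM hβM hγ h
      -- `θ` and `γ` are angles of the same matrix, but `γ` is not assumed sorted. The first-order
      -- estimate with `s = 0` compares them.
      have hrel : angleConj Z θ = angleConj T (fun k => 0 * β k) * angleConj V γ := by
        simp only [zero_mul, angleConj_zero hT, Matrix.one_mul]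
        rw [hZeq, h]
        simp
      have := sum_mul_add_le_of_angleConj_eq_mul hV hZ hT hrel hK0 hK hβM hb' hb hμ hθ
      simpa using this
    | succ j ih =>
      intro hj Z θ hZ hθ hθpi hZeq
      obtain ⟨Y, hY, φ, hφ, hφpi, hYeq⟩ := exists_eq_angleConj
        (mul_mem (angleConj_mem hT (fun k => (1 - (j : ℝ) / N) * β k)) (angleConj_mem hU α))
      have hprev := ih (by omega) Y φ hY hφ hφpi hYeq.symm
      have hb := abs_angle_le_of_angleConj_mul hU hZ hT hM hαM (hbd _ hj) hθpi hZeq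
      have hb' := abs_angle_le_of_angleConj_mul hU hY hT hM hαM (hbd j (by omega)) hφpi
        hYeq.symm
      have hrel : angleConj Z θ = angleConj T (fun k => (-(1 / N : ℝ)) * β k) *
          angleConj Y φ := by
        rw [hZeq, ← hYeq, ← Matrix.mul_assoc, angleConj_mul hT]
        congr 2
        funext k
        push_cast
        ring
      have hstep := sum_mul_add_le_of_angleConj_eq_mul hY hZ hT hrel hK0 hK hβM hb' hb hμ hθ
      have hds := mul_le_mul_of_nonneg_left (sum_mul_sum_le_of_mem_doublyStochastic
        (overlap_mem_doublyStochastic hY hT) hμ hβ') (show (0 : ℝ) ≤ 1 / N by positivity)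
      rw [← hC, neg_sq] at hstep
      push_cast
      linarith
  refine le_of_forall_pos_le_add fun ε hε => ?_
  obtain ⟨N, hN⟩ := exists_nat_gt (C / ε)
  have hN0 : (0 : ℝ) < N := lt_of_le_of_lt (by positivity) hN
  have hfin := main N (by exact_mod_cast hN0) N le_rfl U α hU hα'
    (fun k => (hα k).le.trans (by linarith [Real.pi_pos])) (by
      simp only [div_self hN0.ne', sub_self, zero_mul, angleConj_zero hT, Matrix.one_mul])
  have hsimp : (N : ℝ) * ((1 / N) * ∑ k, μ k * β k + C * (1 / N) ^ 2) =
      ∑ k, μ k * β k + C / N := by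
    field_simp
  rw [hsimp] at hfin
  have : C / N ≤ ε := by
    rw [div_le_iff₀ hN0]
    rw [div_lt_iff₀ hε] at hN
    linarith
  linarith

end Product

/-! ### Convexity, chords and piecewise linearity on the real line. -/

section RealFunctions

/-- If `f` rose above a chord, the difference would have a positive maximum. At its leftmost
maximizer the midpoint inequality fails, because the left neighbour is strictly smaller. -/
theorem convexOn_Icc_of_midpoint {f : ℝ → ℝ} {a b : ℝ} (hf : ContinuousOn f (Set.Icc a b))
    (hmid : ∀ t s : ℝ, 0 ≤ s → a ≤ t - s → t + s ≤ b → 2 * f t ≤ f (t - s) + f (t + s)) :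
    ConvexOn ℝ (Set.Icc a b) f := by
  refine LinearOrder.convexOn_of_lt (convex_Icc a b) fun p hp q hq hpq u v hu hv huv => ?_
  simp only [smul_eq_mul]
  set r := u * p + v * q with hr
  have hu1 : u = 1 - v := by linarith
  set m := (f q - f p) / (q - p) with hm
  have hm' : m * (q - p) = f q - f p := div_mul_cancel₀ _ (by linarith)
  set h := fun t => f t - (f p + m * (t - p)) with hh
  have hsub : Set.Icc p q ⊆ Set.Icc a b := Set.Icc_subset_Icc hp.1 hq.2
  have hcont : ContinuousOn h (Set.Icc p q) :=
    (hf.mono hsub).sub (by fun_prop)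
  have hp0 : h p = 0 := by simp [hh]
  have hq0 : h q = 0 := by simp only [hh]; rw [hm']; ring
  have hrmem : r ∈ Set.Icc p q := by constructor <;> rw [hr, hu1] <;> nlinarith
  have hgoal : h r ≤ 0 := by
    obtain ⟨c, hc, hmax⟩ := isCompact_Icc.exists_isMaxOn (Set.nonempty_Icc.2 hpq.le) hcont
    by_contra! hpos
    have hM : 0 < h c := hpos.trans_le (hmax hrmem)
    have hclosed : IsClosed (Set.Icc p q ∩ h ⁻¹' {h c}) :=
      hcont.preimage_isClosed_of_isClosed isClosed_Icc isClosed_singleton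
    have hcomp : IsCompact (Set.Icc p q ∩ h ⁻¹' {h c}) :=
      isCompact_Icc.of_isClosed_subset hclosed Set.inter_subset_left
    obtain ⟨e, ⟨he, hec⟩, hleast⟩ := hcomp.exists_isLeast ⟨c, hc, rfl⟩
    have hec' : h e = h c := hec
    have hpe : p < e := lt_of_le_of_ne he.1 fun heq => by rw [← heq, hp0] at hec'; linarith
    have heq : e < q := lt_of_le_of_ne he.2 fun heq => by rw [heq, hq0] at hec'; linarith
    set d := min (e - p) (q - e) with hd
    have hd0 : 0 < d := lt_min (by linarith) (by linarith)
    have hd1 : d ≤ e - p := min_le_left _ _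
    have hd2 : d ≤ q - e := min_le_right _ _
    have h1 := hmid e d hd0.le (by linarith [hp.1]) (by linarith [hq.2])
    have hm1 : e - d ∈ Set.Icc p q := ⟨by linarith, by linarith⟩
    have hm2 : e + d ∈ Set.Icc p q := ⟨by linarith, by linarith⟩
    have h2 : h (e - d) < h c := lt_of_le_of_ne (hmax hm1) fun heq => by
      have := hleast ⟨hm1, heq⟩
      linarith
    have h3 : h (e + d) ≤ h c := hmax hm2
    have h4 : 2 * h e ≤ h (e - d) + h (e + d) := by
      simp only [hh]
      linarith
    linarith
  have : u * f p + v * f q = f p + m * (r - p) := by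
    have : r - p = v * (q - p) := by rw [hr, hu1]; ring
    rw [this, mul_left_comm, hm', hu1]
    ring
  rw [this]
  simpa [hh] using hgoal

/-- A convex function that meets one of its chords at an interior point is linear on it. -/
theorem linearOnIcc_of_convexOn_of_eq {f : ℝ → ℝ} {p q u v : ℝ} (hpq : p < q)
    (hf : ConvexOn ℝ (Set.Icc p q) f) (hu : 0 < u) (hv : 0 < v) (huv : u + v = 1)
    (heq : u * f p + v * f q ≤ f (u * p + v * q)) : LinearOnIcc f p q := by
  set m := (f q - f p) / (q - p) with hm
  have hm' : m * (q - p) = f q - f p := div_mul_cancel₀ _ (by linarith)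
  have hpm : p ∈ Set.Icc p q := Set.left_mem_Icc.2 hpq.le
  have hqm : q ∈ Set.Icc p q := Set.right_mem_Icc.2 hpq.le
  have hup : ∀ t ∈ Set.Icc p q, f t ≤ f p + m * (t - p) := by
    intro t ht
    have h := hf.2 hpm hqm
      (show 0 ≤ (q - t) / (q - p) from div_nonneg (by linarith [ht.2]) (by linarith))
      (show 0 ≤ (t - p) / (q - p) from div_nonneg (by linarith [ht.1]) (by linarith))
      (by rw [← add_div]; rw [div_eq_one_iff_eq] <;> linarith)
    have hne : q - p ≠ 0 := by linarith
    simp only [smul_eq_mul] at h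
    have e1 : (q - t) / (q - p) * p + (t - p) / (q - p) * q = t := by field_simp; ring
    have e2 : (q - t) / (q - p) * f p + (t - p) / (q - p) * f q = f p + m * (t - p) := by
      rw [hm]; field_simp; ring
    rwa [e1, e2] at h
  set r := u * p + v * q with hr
  have hu1 : u = 1 - v := by linarith
  have hrp : p < r := by rw [hr, hu1]; nlinarith
  have hrq : r < q := by
    have hv1 : v = 1 - u := by linarith
    rw [hr, hv1]; nlinarith
  have hfr : f p + m * (r - p) ≤ f r := by
    have : u * f p + v * f q = f p + m * (r - p) := by
      have : r - p = v * (q - p) := by rw [hr, hu1]; ring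
      rw [this, mul_left_comm, hm', hu1]
      ring
    rwa [← this]
  refine ⟨m, f p - m * p, fun t ht => le_antisymm (by linarith [hup t ht]) ?_⟩
  -- A value strictly below the chord on either side of `r` would, by convexity between `t` and the
  -- far endpoint, pull `f r` below the chord as well.
  rcases lt_trichotomy t r with h | h | h
  · have := hf.2 ht hqm
      (show 0 ≤ (q - r) / (q - t) from div_nonneg (by linarith) (by linarith))
      (show 0 ≤ (r - t) / (q - t) from div_nonneg (by linarith) (by linarith))
      (by rw [← add_div]; rw [div_eq_one_iff_eq] <;> linarith)
    have hne : q - t ≠ 0 := by linarith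
    simp only [smul_eq_mul] at this
    have e1 : (q - r) / (q - t) * t + (r - t) / (q - t) * q = r := by field_simp; ring
    rw [e1, div_mul_eq_mul_div, div_mul_eq_mul_div, ← add_div, le_div_iff₀ (by linarith)] at this
    have hfq : f q = f p + m * (q - p) := by linarith
    have h3 : (f p + m * (r - p)) * (q - t) ≤ f r * (q - t) :=
      mul_le_mul_of_nonneg_right hfr (by linarith)
    have h4 : 0 ≤ (q - r) * (f t - (f p + m * (t - p))) := by rw [hfq] at this; linarith
    have h5 : 0 ≤ f t - (f p + m * (t - p)) := nonneg_of_mul_nonneg_right h4 (by linarith)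
    linarith
  · rw [h]; linarith
  · have := hf.2 hpm ht
      (show 0 ≤ (t - r) / (t - p) from div_nonneg (by linarith) (by linarith))
      (show 0 ≤ (r - p) / (t - p) from div_nonneg (by linarith) (by linarith))
      (by rw [← add_div]; rw [div_eq_one_iff_eq] <;> linarith)
    have hne : t - p ≠ 0 := by linarith
    simp only [smul_eq_mul] at this
    have e1 : (t - r) / (t - p) * p + (r - p) / (t - p) * t = r := by field_simp; ring
    rw [e1, div_mul_eq_mul_div, div_mul_eq_mul_div, ← add_div, le_div_iff₀ (by linarith)] at this
    have h3 : (f p + m * (r - p)) * (t - p) ≤ f r * (t - p) :=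
      mul_le_mul_of_nonneg_right hfr (by linarith)
    have h4 : 0 ≤ (r - p) * (f t - (f p + m * (t - p))) := by linarith
    have h5 : 0 ≤ f t - (f p + m * (t - p)) := nonneg_of_mul_nonneg_right h4 (by linarith)
    linarith

theorem LinearOnIcc.mono {f : ℝ → ℝ} {a b p q : ℝ} (h : LinearOnIcc f a b) (hp : a ≤ p)
    (hq : q ≤ b) : LinearOnIcc f p q := by
  obtain ⟨c, d, h⟩ := h
  exact ⟨c, d, fun t ht => h t ⟨hp.trans ht.1, ht.2.trans hq⟩⟩

theorem LinearOnIcc.sub {f g : ℝ → ℝ} {a b : ℝ} (hf : LinearOnIcc f a b)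
    (hg : LinearOnIcc g a b) : LinearOnIcc (fun t => f t - g t) a b := by
  obtain ⟨c, d, hf⟩ := hf
  obtain ⟨c', d', hg⟩ := hg
  exact ⟨c - c', d - d', fun t ht => by simp only [hf t ht, hg t ht]; ring⟩

theorem LinearOnIcc.not_strictConvexOn {f : ℝ → ℝ} {a b p q : ℝ} (h : LinearOnIcc f p q)
    (hp : a ≤ p) (hpq : p < q) (hq : q ≤ b) : ¬ StrictConvexOn ℝ (Set.Icc a b) f := by
  intro hf
  obtain ⟨c, d, h⟩ := h
  have := hf.2 (show p ∈ Set.Icc a b from ⟨hp, hpq.le.trans hq⟩)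
    (show q ∈ Set.Icc a b from ⟨hp.trans hpq.le, hq⟩) hpq.ne
    (show (0 : ℝ) < 1 / 2 by norm_num) (show (0 : ℝ) < 1 / 2 by norm_num) (by norm_num)
  simp only [smul_eq_mul] at this
  rw [h p ⟨le_rfl, hpq.le⟩, h q ⟨hpq.le, le_rfl⟩, h _ ⟨by linarith, by linarith⟩] at this
  linarith

/-- Two linear functions whose order at `m` differs from that at `p` cross in between. -/
theorem exists_crossing {c d c' d' m p : ℝ} (h1 : c' * m + d' ≤ c * m + d)
    (h2 : c * p + d < c' * p + d') :
    c ≠ c' ∧ ∃ r : ℝ, r = (d' - d) / (c - c') ∧ (m ≤ r ∧ r < p ∨ p < r ∧ r ≤ m) := by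
  have hne : c ≠ c' := by rintro rfl; linarith
  refine ⟨hne, _, rfl, ?_⟩
  rcases lt_or_gt_of_ne hne with h | h
  · left
    have h' : c - c' < 0 := by linarith
    rw [le_div_iff_of_neg h', div_lt_iff_of_neg h']
    constructor <;> nlinarith
  · right
    have h' : 0 < c - c' := by linarith
    rw [div_le_iff₀ h', lt_div_iff₀ h']
    constructor <;> nlinarith

/-- The maximum of finitely many linear functions is piecewise linear. -/
theorem piecewiseLinearOnIcc_of_isMax {ι : Type*} [Fintype ι] {f : ℝ → ℝ} {c d : ι → ℝ} {a b : ℝ}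
    (hab : a < b) (hle : ∀ t ∈ Set.Icc a b, ∀ i, c i * t + d i ≤ f t)
    (hmem : ∀ t ∈ Set.Icc a b, ∃ i, f t = c i * t + d i) : PiecewiseLinearOnIcc f a b := by
  classical
  -- Breakpoints are the abscissae where two lines cross. A pair of equal slopes contributes the
  -- junk value `0`, which at worst is a superfluous breakpoint.
  set X : Finset ℝ := (Finset.univ.image fun ij : ι × ι => (d ij.2 - d ij.1) / (c ij.1 - c ij.2))
    with hX
  set S : Finset ℝ := insert a (insert b (X.filter fun t => a < t ∧ t < b)) with hS
  have hSIcc : ∀ t ∈ S, t ∈ Set.Icc a b := by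
    intro t ht
    simp only [hS, Finset.mem_insert, Finset.mem_filter] at ht
    rcases ht with rfl | rfl | ⟨-, h1, h2⟩
    · exact ⟨le_rfl, hab.le⟩
    · exact ⟨hab.le, le_rfl⟩
    · exact ⟨h1.le, h2.le⟩
  have haS : a ∈ S := Finset.mem_insert_self _ _
  have hbS : b ∈ S := Finset.mem_insert_of_mem (Finset.mem_insert_self _ _)
  have hcard : S.card = (S.card - 1) + 1 := by
    have := Finset.card_pos.2 ⟨a, haS⟩
    omega
  set N := S.card - 1
  set s := S.orderEmbOfFin hcard with hs
  have hsS : ∀ i, s i ∈ S := fun i => S.orderEmbOfFin_mem hcard i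
  have hsurj : ∀ t ∈ S, ∃ i, s i = t := fun t ht => by
    have : t ∈ Set.range s := by rw [hs, S.range_orderEmbOfFin hcard]; exact ht
    exact this
  refine ⟨N, s, s.strictMono, ?_, ?_, fun i => ?_⟩
  · obtain ⟨i, hi⟩ := hsurj a haS
    exact le_antisymm (by rw [← hi]; exact s.monotone (Fin.zero_le i)) (hSIcc _ (hsS 0)).1
  · obtain ⟨i, hi⟩ := hsurj b hbS
    exact le_antisymm (hSIcc _ (hsS _)).2 (by rw [← hi]; exact s.monotone (Fin.le_last i))
  · have hlt : s i.castSucc < s i.succ := s.strictMono i.castSucc_lt_succ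
    set p := s i.castSucc
    set q := s i.succ
    have hp := hSIcc p (hsS _)
    have hq := hSIcc q (hsS _)
    have hno : ∀ t ∈ X, ¬ (p < t ∧ t < q) := by
      rintro t ht ⟨h1, h2⟩
      have htS : t ∈ S := by
        simp only [hS, Finset.mem_insert, Finset.mem_filter]
        exact Or.inr (Or.inr ⟨ht, hp.1.trans_lt h1, h2.trans_le hq.2⟩)
      obtain ⟨j, rfl⟩ := hsurj t htS
      have h1' := s.lt_iff_lt.1 h1
      have h2' := s.lt_iff_lt.1 h2
      rw [Fin.lt_def] at h1' h2'
      simp only [Fin.val_castSucc, Fin.val_succ] at h1' h2'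
      omega
    -- The line attaining the maximum at the midpoint attains it throughout: being overtaken would
    -- force a crossing strictly between consecutive breakpoints.
    set m := (p + q) / 2 with hm
    have hmem' : m ∈ Set.Icc a b := ⟨by linarith [hp.1], by linarith [hq.2]⟩
    obtain ⟨j, hj⟩ := hmem m hmem'
    refine ⟨c j, d j, fun t ht => ?_⟩
    have htab : t ∈ Set.Icc a b := ⟨hp.1.trans ht.1, ht.2.trans hq.2⟩
    refine le_antisymm ?_ (hle t htab j)
    obtain ⟨k, hk⟩ := hmem t htab
    rw [hk]
    by_contra! hcon
    have h1 := hle m hmem' k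
    rw [hj] at h1
    obtain ⟨-, r, hr, hcase⟩ := exists_crossing h1 hcon
    refine hno r ?_ ?_
    · rw [hX, hr]
      exact Finset.mem_image.2 ⟨(j, k), Finset.mem_univ _, rfl⟩
    · rcases hcase with ⟨h3, h4⟩ | ⟨h3, h4⟩
      · exact ⟨by linarith, h4.trans_le ht.2⟩
      · exact ⟨ht.1.trans_lt h3, by linarith⟩

end RealFunctions

/-! ### Differentiation of exponential sums. -/

section ExponentialSums

theorem hasDerivAt_sum_mul_exp {ι : Type*} [Fintype ι] (g : ι → ℂ) (a : ι → ℝ) (t : ℝ) :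
    HasDerivAt (fun t : ℝ => ∑ j, g j * Complex.exp ((a j * t : ℝ) * Complex.I))
      (∑ j, (g j * (a j * Complex.I)) * Complex.exp ((a j * t : ℝ) * Complex.I)) t := by
  refine HasDerivAt.fun_sum fun j _ => ?_
  have h1 : HasDerivAt (fun t : ℝ => ((a j * t : ℝ) : ℂ) * Complex.I) (a j * Complex.I) t := by
    have := ((hasDerivAt_id t).const_mul (a j)).ofReal_comp.mul_const Complex.I
    simpa using this
  have := h1.cexp.const_mul (g j)
  refine this.congr_deriv ?_
  ring

/-- Two exponential sums that agree on an interval have the same second derivatives on it. -/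
theorem sum_sq_mul_exp_eq {ι κ : Type*} [Fintype ι] [Fintype κ] {g : ι → ℂ} {a : ι → ℝ}
    {h : κ → ℂ} {c : κ → ℝ} {p q : ℝ}
    (heq : ∀ t ∈ Set.Ioo p q, ∑ j, g j * Complex.exp ((a j * t : ℝ) * Complex.I) =
      ∑ k, h k * Complex.exp ((c k * t : ℝ) * Complex.I)) {t : ℝ} (ht : t ∈ Set.Ioo p q) :
    ∑ j, (g j * a j ^ 2) * Complex.exp ((a j * t : ℝ) * Complex.I) =
      ∑ k, (h k * c k ^ 2) * Complex.exp ((c k * t : ℝ) * Complex.I) := by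
  have step : ∀ {g : ι → ℂ} {h : κ → ℂ},
      (∀ t ∈ Set.Ioo p q, ∑ j, g j * Complex.exp ((a j * t : ℝ) * Complex.I) =
        ∑ k, h k * Complex.exp ((c k * t : ℝ) * Complex.I)) →
      ∀ t ∈ Set.Ioo p q,
        ∑ j, (g j * (a j * Complex.I)) * Complex.exp ((a j * t : ℝ) * Complex.I) =
        ∑ k, (h k * (c k * Complex.I)) * Complex.exp ((c k * t : ℝ) * Complex.I) := by
    intro g h heq t ht
    have h1 := hasDerivAt_sum_mul_exp g a t
    have h2 := hasDerivAt_sum_mul_exp h c t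
    refine h1.unique (h2.congr_of_eventuallyEq ?_)
    filter_upwards [Ioo_mem_nhds ht.1 ht.2] with r hr using heq r hr
  have h2 := step (step heq) t ht
  have e : ∀ (z : ℂ) (r : ℝ), z * (r * Complex.I) * (r * Complex.I) = -(z * r ^ 2) := by
    intro z r
    linear_combination (z * r ^ 2) * Complex.I_mul_I
  simp only [e, neg_mul, Finset.sum_neg_distrib] at h2
  exact neg_injective h2

end ExponentialSums

/-! ### Convexity and rigidity along a one-parameter path. -/

section Path

variable {n : ℕ}

/-- `W` is the one-parameter path of unitary matrices generated by the Hermitian matrix with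
eigenvalues `a` and eigenvectors the columns of `T`, and `θ t` lists in non-increasing order
the arguments, in `(-π/2, π/2)`, of the eigenvalues of `W t`. -/
structure IsAnglePath (T : Matrix (Fin n) (Fin n) ℂ) (a : Fin n → ℝ)
    (W : ℝ → Matrix (Fin n) (Fin n) ℂ) (θ : ℝ → Fin n → ℝ) (t₀ : ℝ) : Prop where
  mem : T ∈ unitaryGroup (Fin n) ℂ
  path_mem : ∀ t, W t ∈ unitaryGroup (Fin n) ℂ
  path_add : ∀ t s, W (t + s) = angleConj T (fun k => s * a k) * W t
  exists_eq : ∀ t ∈ Set.Icc 0 t₀, ∃ U ∈ unitaryGroup (Fin n) ℂ, W t = angleConj U (θ t)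
  antitone : ∀ t ∈ Set.Icc 0 t₀, Antitone (θ t)
  abs_lt : ∀ t ∈ Set.Icc 0 t₀, ∀ k, |θ t k| < Real.pi / 2

variable {T : Matrix (Fin n) (Fin n) ℂ} {a : Fin n → ℝ} {W : ℝ → Matrix (Fin n) (Fin n) ℂ}
  {θ : ℝ → Fin n → ℝ} {t₀ : ℝ}

theorem IsAnglePath.exists_first_order_bound (h : IsAnglePath T a W θ t₀) {μ : Fin n → ℝ}
    (hμ : Antitone μ) : ∃ C : ℝ, 0 ≤ C ∧ ∀ t ∈ Set.Icc 0 t₀, ∀ t' ∈ Set.Icc 0 t₀,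
      ∀ U ∈ unitaryGroup (Fin n) ℂ, W t = angleConj U (θ t) →
      weightedAngleSum μ θ t + (t' - t) * ∑ k, μ k * ∑ j, overlap U T k j * a j -
        C * (t' - t) ^ 2 ≤ weightedAngleSum μ θ t' := by
  obtain ⟨K, hK0, hK⟩ := exists_abs_sub_sin_le (α := Real.pi / 2) (by linarith [Real.pi_pos])
  refine ⟨(∑ k, |μ k|) * ((K + 1) * ‖a‖ ^ 2),
    mul_nonneg (Finset.sum_nonneg fun _ _ => abs_nonneg _) (by positivity), ?_⟩
  intro t ht t' ht' U hU hUt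
  obtain ⟨V, hV, hVt⟩ := h.exists_eq t' ht'
  have hrel : angleConj V (θ t') = angleConj T (fun j => (t' - t) * a j) *
      angleConj U (θ t) := by
    rw [← hVt, ← hUt, ← h.path_add, add_sub_cancel]
  exact sum_mul_add_le_of_angleConj_eq_mul hU hV h.mem hrel hK0 hK
    (fun j => norm_le_pi_norm a j) (fun k => (h.abs_lt t ht k).le)
    (fun k => (h.abs_lt t' ht' k).le) hμ (h.antitone t' ht')

/-- `W(t)² = (W(t) e^{isx}) (e^{-isx} W(t))`, where the first factor is conjugate to `W(t+s)` and
the second is `W(t-s)`. The square has angles `2 θ t k`, still in `(-π, π)`, so subadditivity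
applies. -/
theorem IsAnglePath.two_mul_le (h : IsAnglePath T a W θ t₀) {μ : Fin n → ℝ}
    (hμ : Antitone μ) (t s : ℝ) (hs : 0 ≤ s) (h0 : 0 ≤ t - s) (h1 : t + s ≤ t₀) :
    2 * weightedAngleSum μ θ t ≤ weightedAngleSum μ θ (t - s) + weightedAngleSum μ θ (t + s) := by
  have ht : t ∈ Set.Icc 0 t₀ := ⟨by linarith, by linarith⟩
  have ht1 : t - s ∈ Set.Icc 0 t₀ := ⟨by linarith, by linarith⟩
  have ht2 : t + s ∈ Set.Icc 0 t₀ := ⟨by linarith, by linarith⟩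
  obtain ⟨U, hU, hUt⟩ := h.exists_eq t ht
  obtain ⟨U₁, hU₁, hU₁t⟩ := h.exists_eq (t - s) ht1
  obtain ⟨U₂, hU₂, hU₂t⟩ := h.exists_eq (t + s) ht2
  have hmem := h.path_mem t
  have hB : W t * angleConj T (fun k => s * a k) = angleConj (W t * U₂) (θ (t + s)) := by
    rw [angleConj.eq_def (W t * U₂), ← unitaryConj_conj, ← angleConj, ← hU₂t, h.path_add]
    simp only [Matrix.mul_assoc, mul_star_of_mem hmem, Matrix.mul_one]
  have hA : angleConj U₁ (θ (t - s)) = angleConj T (fun k => -s * a k) * W t := by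
    rw [← hU₁t, sub_eq_add_neg, h.path_add]
  have hrel : angleConj U (fun k => 2 * θ t k) =
      angleConj (W t * U₂) (θ (t + s)) * angleConj U₁ (θ (t - s)) := by
    rw [← hB, hA, Matrix.mul_assoc, ← Matrix.mul_assoc (angleConj T _) (angleConj T _),
      angleConj_mul h.mem]
    simp only [neg_mul, add_neg_cancel, angleConj_zero h.mem, Matrix.one_mul]
    rw [hUt, angleConj_mul hU]
    simp only [two_mul]
  have := sum_mul_le_of_angleConj_eq_mul hU₁ hU (mul_mem hmem hU₂) (h.abs_lt _ ht1)
    (h.abs_lt _ ht2) (fun k => by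
      rw [abs_mul, abs_two]
      linarith [h.abs_lt t ht k]) (h.antitone _ ht1) (h.antitone _ ht2) hμ hrel
  refine le_trans (le_of_eq ?_) this
  rw [weightedAngleSum, Finset.mul_sum]
  exact Finset.sum_congr rfl fun k _ => by ring

theorem abs_sum_mul_overlap_le {U : Matrix (Fin n) (Fin n) ℂ}
    (hU : U ∈ unitaryGroup (Fin n) ℂ) (hT : T ∈ unitaryGroup (Fin n) ℂ) (μ a : Fin n → ℝ) :
    |∑ k, μ k * ∑ j, overlap U T k j * a j| ≤ (∑ k, |μ k|) * ‖a‖ := by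
  have hp := overlap_mem_doublyStochastic hU hT
  have hrow : ∀ k, |∑ j, overlap U T k j * a j| ≤ ‖a‖ := fun k => by
    calc _ ≤ ∑ j, |overlap U T k j * a j| := Finset.abs_sum_le_sum_abs _ _
      _ ≤ ∑ j, overlap U T k j * ‖a‖ := by
          refine Finset.sum_le_sum fun j _ => ?_
          rw [abs_mul, abs_of_nonneg (nonneg_of_mem_doublyStochastic hp)]
          exact mul_le_mul_of_nonneg_left (norm_le_pi_norm a j)
            (nonneg_of_mem_doublyStochastic hp)
      _ = ‖a‖ := by rw [← Finset.sum_mul, sum_row_of_mem_doublyStochastic hp, one_mul]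
  calc _ ≤ ∑ k, |μ k * ∑ j, overlap U T k j * a j| := Finset.abs_sum_le_sum_abs _ _
    _ ≤ ∑ k, |μ k| * ‖a‖ := by
        refine Finset.sum_le_sum fun k _ => ?_
        rw [abs_mul]
        exact mul_le_mul_of_nonneg_left (hrow k) (abs_nonneg _)
    _ = _ := by rw [Finset.sum_mul]

/-- The first-order bound, used with `t` and `t'` in both roles, gives a Lipschitz estimate since
its linear coefficient is uniformly bounded. -/
theorem IsAnglePath.continuousOn (h : IsAnglePath T a W θ t₀) {μ : Fin n → ℝ}
    (hμ : Antitone μ) : ContinuousOn (weightedAngleSum μ θ) (Set.Icc 0 t₀) := by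
  obtain ⟨C, hC, hb⟩ := h.exists_first_order_bound hμ
  set D := (∑ k, |μ k|) * ‖a‖
  have hD : 0 ≤ D := mul_nonneg (Finset.sum_nonneg fun _ _ => abs_nonneg _) (norm_nonneg _)
  have key : ∀ t ∈ Set.Icc 0 t₀, ∀ t' ∈ Set.Icc 0 t₀,
      weightedAngleSum μ θ t - weightedAngleSum μ θ t' ≤ (D + C * |t₀|) * |t - t'| := by
    intro t ht t' ht'
    obtain ⟨U, hU, hUt⟩ := h.exists_eq t ht
    have h1 := hb t ht t' ht' U hU hUt
    have h2 : |(t' - t) * ∑ k, μ k * ∑ j, overlap U T k j * a j| ≤ |t - t'| * D := by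
      rw [abs_mul, abs_sub_comm]
      exact mul_le_mul_of_nonneg_left (abs_sum_mul_overlap_le hU h.mem μ a) (abs_nonneg _)
    have h3 : (t' - t) ^ 2 ≤ |t₀| * |t - t'| := by
      rw [← sq_abs, abs_sub_comm, sq]
      refine mul_le_mul_of_nonneg_right ?_ (abs_nonneg _)
      refine le_trans ?_ (le_abs_self t₀)
      exact abs_le.2 ⟨by linarith [ht.1, ht'.2], by linarith [ht.2, ht'.1]⟩
    have h4 := mul_le_mul_of_nonneg_left h3 hC
    have h5 := (abs_le.1 h2).1
    linarith
  have hlip : LipschitzOnWith (Real.toNNReal (D + C * |t₀|)) (weightedAngleSum μ θ)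
      (Set.Icc 0 t₀) := by
    refine LipschitzOnWith.of_dist_le_mul fun t ht t' ht' => ?_
    rw [Real.coe_toNNReal _ (by positivity), Real.dist_eq, Real.dist_eq, abs_le]
    have h1 := key t ht t' ht'
    have h2 := key t' ht' t ht
    rw [abs_sub_comm] at h2
    exact ⟨by linarith, h1⟩
  exact hlip.continuousOn

theorem IsAnglePath.convexOn (h : IsAnglePath T a W θ t₀) {μ : Fin n → ℝ}
    (hμ : Antitone μ) : ConvexOn ℝ (Set.Icc 0 t₀) (weightedAngleSum μ θ) :=
  convexOn_Icc_of_midpoint (h.continuousOn hμ) (h.two_mul_le hμ)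

/-- Constant weights `1` and `-1` are both non-increasing, so the sum of the angles is both convex
and concave. -/
theorem IsAnglePath.linearOnIcc_sum (h : IsAnglePath T a W θ t₀) (ht₀ : 0 < t₀) :
    LinearOnIcc (fun t => ∑ k, θ t k) 0 t₀ := by
  have h1 := h.convexOn (μ := fun _ => 1) fun _ _ _ => le_rfl
  have h2 := h.convexOn (μ := fun _ => -1) fun _ _ _ => le_rfl
  have e1 : weightedAngleSum (fun _ => 1) θ = fun t => ∑ k, θ t k := by
    funext t; simp [weightedAngleSum]
  have e2 : weightedAngleSum (fun _ => -1) θ = fun t => -∑ k, θ t k := by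
    funext t; simp [weightedAngleSum]
  rw [e1] at h1
  rw [e2] at h2
  have hhalf : (0 : ℝ) < 1 / 2 := by norm_num
  refine linearOnIcc_of_convexOn_of_eq ht₀ h1 hhalf hhalf (by norm_num) ?_
  have := h2.2 (Set.left_mem_Icc.2 ht₀.le) (Set.right_mem_Icc.2 ht₀.le) hhalf.le hhalf.le
    (by norm_num)
  simp only [smul_eq_mul] at this
  linarith

theorem eq_zero_of_forall_le_mul {w C : ℝ} {p q t : ℝ} (ht : t ∈ Set.Ioo p q)
    (h : ∀ t' ∈ Set.Ioo p q, 0 ≤ (t' - t) * w + C * (t' - t) ^ 2) : w = 0 := by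
  have hd : HasDerivAt (fun t' : ℝ => (t' - t) * w + C * (t' - t) ^ 2) w t := by
    have h1 := (hasDerivAt_id t).sub_const t
    have := (h1.mul_const w).add ((h1.pow 2).const_mul C)
    refine this.congr_deriv ?_
    simp
  have hmin : IsLocalMin (fun t' : ℝ => (t' - t) * w + C * (t' - t) ^ 2) t := by
    filter_upwards [Ioo_mem_nhds ht.1 ht.2] with r hr
    simpa using h r hr
  exact hmin.hasDerivAt_eq_zero hd

theorem antitone_indicator {s : Finset (Fin n)} (hs : IsLowerSet (s : Set (Fin n))) :
    Antitone fun k => if k ∈ s then (1 : ℝ) else 0 := by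
  intro i j hij
  by_cases hj : j ∈ s
  · simp [hj, show i ∈ s from hs hij hj]
  · simp only [hj, if_false]
    split_ifs <;> norm_num

/-- For linear angles the first-order bound on both sides of `t` forces the pairing of every
non-increasing `μ` with the slope discrepancy to vanish. -/
theorem IsAnglePath.slope_eq (h : IsAnglePath T a W θ t₀) {c d : Fin n → ℝ} {p q : ℝ}
    (hp : 0 ≤ p) (hq : q ≤ t₀) (hlin : ∀ t ∈ Set.Ioo p q, ∀ k, θ t k = c k * t + d k)
    {t : ℝ} (ht : t ∈ Set.Ioo p q) {U : Matrix (Fin n) (Fin n) ℂ}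
    (hU : U ∈ unitaryGroup (Fin n) ℂ) (hUt : W t = angleConj U (θ t)) (k : Fin n) :
    c k = ∑ j, overlap U T k j * a j := by
  have hsub : ∀ {r}, r ∈ Set.Ioo p q → r ∈ Set.Icc 0 t₀ := fun hr =>
    ⟨hp.trans hr.1.le, hr.2.le.trans hq⟩
  set e := fun k => c k - ∑ j, overlap U T k j * a j with he
  have hzero : ∀ μ : Fin n → ℝ, Antitone μ → ∑ k, μ k * e k = 0 := by
    intro μ hμ
    obtain ⟨C, -, hb⟩ := h.exists_first_order_bound hμ
    refine eq_zero_of_forall_le_mul (C := C) ht fun t' ht' => ?_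
    have h1 := hb t (hsub ht) t' (hsub ht') U hU hUt
    have h2 : weightedAngleSum μ θ t' - weightedAngleSum μ θ t = (t' - t) * ∑ k, μ k * c k := by
      rw [weightedAngleSum, weightedAngleSum, ← Finset.sum_sub_distrib, Finset.mul_sum]
      refine Finset.sum_congr rfl fun k _ => ?_
      rw [hlin t ht, hlin t' ht']
      ring
    have h3 : ∑ k, μ k * e k = ∑ k, μ k * c k - ∑ k, μ k * ∑ j, overlap U T k j * a j := by
      rw [← Finset.sum_sub_distrib]
      exact Finset.sum_congr rfl fun k _ => mul_sub _ _ _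
    rw [h3, mul_sub]
    linarith
  have hs : ∀ s : Finset (Fin n), IsLowerSet (s : Set (Fin n)) → ∑ k ∈ s, e k = 0 := by
    intro s hs
    have := hzero _ (antitone_indicator hs)
    simpa using this
  -- Two consecutive initial segments differ by `k` alone, which isolates `e k`.
  have h1 := hs (Finset.Iic k) (by rw [Finset.coe_Iic]; exact isLowerSet_Iic k)
  have h2 := hs (Finset.Iio k) (by rw [Finset.coe_Iio]; exact isLowerSet_Iio k)
  rw [← Finset.Iio_insert, Finset.sum_insert (by simp), h2, add_zero] at h1
  exact sub_eq_zero.1 h1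

theorem trace_unitaryConj_mul (U M : Matrix (Fin n) (Fin n) ℂ) (d : Fin n → ℂ) :
    (unitaryConj U d * M).trace = ∑ j, (star U * M * U) j j * d j := by
  rw [unitaryConj, Matrix.mul_assoc, Matrix.mul_assoc, trace_mul_comm, Matrix.mul_assoc,
    trace_mul_comm]
  simp only [trace, diag_apply, mul_diagonal]

/-- If the angles are linear functions of the parameter on an interval, then the generator of the
path is diagonal in each eigenbasis of the path. -/
theorem IsAnglePath.unitaryConj_eq (h : IsAnglePath T a W θ t₀) {c d : Fin n → ℝ} {p q : ℝ}
    (hp : 0 ≤ p) (hq : q ≤ t₀) (hlin : ∀ t ∈ Set.Ioo p q, ∀ k, θ t k = c k * t + d k)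
    {t : ℝ} (ht : t ∈ Set.Ioo p q) {U : Matrix (Fin n) (Fin n) ℂ}
    (hU : U ∈ unitaryGroup (Fin n) ℂ) (hUt : W t = angleConj U (θ t)) :
    unitaryConj T (fun k => (a k : ℂ)) = unitaryConj U (fun k => (c k : ℂ)) := by
  have hsub : ∀ {r}, r ∈ Set.Ioo p q → r ∈ Set.Icc 0 t₀ := fun hr =>
    ⟨hp.trans hr.1.le, hr.2.le.trans hq⟩
  have hW : ∀ r, W r = angleConj T (fun k => r * a k) * W 0 := fun r => by
    rw [← h.path_add, zero_add]
  have htr : ∀ r ∈ Set.Ioo p q,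
      ∑ j, (star T * W 0 * T) j j * Complex.exp ((a j * r : ℝ) * Complex.I) =
      ∑ k, Complex.exp (d k * Complex.I) * Complex.exp ((c k * r : ℝ) * Complex.I) := by
    intro r hr
    obtain ⟨V, hV, hVr⟩ := h.exists_eq r (hsub hr)
    have h1 : (W r).trace = ∑ k, Complex.exp ((θ r k : ℂ) * Complex.I) := by
      rw [hVr, angleConj, trace_unitaryConj hV]
    rw [hW, angleConj, trace_unitaryConj_mul] at h1
    simp only [mul_comm r] at h1
    rw [h1]
    refine Finset.sum_congr rfl fun k _ => ?_
    rw [hlin r hr, ← Complex.exp_add]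
    push_cast
    ring_nf
  -- Both sides are minus the second derivative of `tr (W t)`. The left one is `tr (x² W(t))`,
  -- computed below in the eigenbasis `U` of `W t`.
  have h2 := sum_sq_mul_exp_eq htr ht
  have hleft : ∑ j, ((star T * W 0 * T) j j * a j ^ 2) *
      Complex.exp ((a j * t : ℝ) * Complex.I) =
      ∑ k, Complex.exp ((θ t k : ℂ) * Complex.I) * ∑ l, (overlap U T k l : ℂ) * a l ^ 2 := by
    have e1 : (unitaryConj T (fun k => (a k : ℂ) ^ 2) * W t).trace =
        ∑ j, ((star T * W 0 * T) j j * a j ^ 2) *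
          Complex.exp ((a j * t : ℝ) * Complex.I) := by
      rw [hW, ← Matrix.mul_assoc, angleConj, unitaryConj_mul h.mem, trace_unitaryConj_mul]
      simp only [mul_assoc, mul_comm t]
    rw [← e1, hUt, trace_mul_comm, angleConj, trace_unitaryConj_mul]
    refine Finset.sum_congr rfl fun k _ => ?_
    rw [star_mul_unitaryConj_mul_apply, mul_comm]
  have hright : ∑ k, (Complex.exp (d k * Complex.I) * c k ^ 2) *
      Complex.exp ((c k * t : ℝ) * Complex.I) =
      ∑ k, Complex.exp ((θ t k : ℂ) * Complex.I) * (c k : ℂ) ^ 2 := by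
    refine Finset.sum_congr rfl fun k _ => ?_
    rw [mul_right_comm, ← Complex.exp_add, hlin t ht]
    push_cast
    ring_nf
  rw [hleft, hright] at h2
  have hpmem := overlap_mem_doublyStochastic hU h.mem
  -- The inner sum is the variance of `a` under row `k` of the overlap, whose mean is `c k` by
  -- `slope_eq`. Positivity of the cosines then kills every term.
  have hre : ∑ k, Real.cos (θ t k) * ∑ l, overlap U T k l * (a l - c k) ^ 2 = 0 := by
    have hvar : ∀ k, ∑ l, overlap U T k l * (a l - c k) ^ 2 =
        ∑ l, overlap U T k l * a l ^ 2 - c k ^ 2 := by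
      intro k
      have hrow := sum_row_of_mem_doublyStochastic hpmem k
      have hck := h.slope_eq hp hq hlin ht hU hUt k
      have : ∀ l, overlap U T k l * (a l - c k) ^ 2 = overlap U T k l * a l ^ 2 -
          2 * c k * (overlap U T k l * a l) + c k ^ 2 * overlap U T k l := fun l => by ring
      simp only [this]
      rw [Finset.sum_add_distrib, Finset.sum_sub_distrib, ← Finset.mul_sum, ← Finset.mul_sum,
        hrow, ← hck]
      ring
    have h3 := congrArg Complex.re h2
    have e3 : ∀ (r s : ℝ), (Complex.exp ((r : ℂ) * Complex.I) * (s : ℂ)).re = Real.cos r * s := by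
      intro r s
      rw [Complex.re_mul_ofReal, Complex.exp_ofReal_mul_I_re]
    simp only [← Complex.ofReal_pow, ← Complex.ofReal_mul, ← Complex.ofReal_sum, Complex.re_sum,
      e3] at h3
    simp only [hvar, mul_sub, Finset.sum_sub_distrib, h3, sub_self]
  have hcos : ∀ k, 0 < Real.cos (θ t k) := fun k =>
    Real.cos_pos_of_mem_Ioo (_root_.abs_lt.1 (h.abs_lt t (hsub ht) k))
  have hterm : ∀ k l, 0 ≤ overlap U T k l * (a l - c k) ^ 2 := fun k l =>
    mul_nonneg (nonneg_of_mem_doublyStochastic hpmem) (sq_nonneg _)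
  have hz : ∀ k l, overlap U T k l * (a l - c k) ^ 2 = 0 := by
    intro k l
    have h4 := (Finset.sum_eq_zero_iff_of_nonneg fun k _ => mul_nonneg (hcos k).le
      (Finset.sum_nonneg fun l _ => hterm k l)).1 hre k (Finset.mem_univ k)
    have h5 := (mul_eq_zero.1 h4).resolve_left (hcos k).ne'
    exact (Finset.sum_eq_zero_iff_of_nonneg fun l _ => hterm k l).1 h5 l (Finset.mem_univ l)
  have hint : star U * T * diagonal (fun k => (a k : ℂ)) =
      diagonal (fun k => (c k : ℂ)) * (star U * T) := by
    ext k l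
    rw [mul_diagonal, diagonal_mul]
    rcases mul_eq_zero.1 (hz k l) with h6 | h6
    · rw [overlap, of_apply, Complex.normSq_eq_zero] at h6
      rw [h6, mul_zero, zero_mul]
    · have : a l = c k := sub_eq_zero.1 (pow_eq_zero_iff two_ne_zero |>.1 h6)
      rw [this, mul_comm]
  refine eq_unitaryConj_of_star_mul_mul hU ?_
  have : star U * unitaryConj T (fun k => (a k : ℂ)) * U =
      (star U * T * diagonal (fun k => (a k : ℂ))) * (star T * U) := by
    simp only [unitaryConj, Matrix.mul_assoc]
  rw [this, hint]
  have h7 : star U * T * (star T * U) = 1 := by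
    rw [Matrix.mul_assoc, ← Matrix.mul_assoc T, mul_star_of_mem h.mem, Matrix.one_mul,
      star_mul_of_mem hU]
  rw [Matrix.mul_assoc, h7, Matrix.mul_one]

end Path

/-! ### The segment `e^{itx} e^{iy}`: supremum formula, commuting case and strict convexity. -/

section Segment

variable {n : ℕ}

theorem norm_le_of_norm_unitaryConj {U : Matrix (Fin n) (Fin n) ℂ}
    (hU : U ∈ unitaryGroup (Fin n) ℂ) (b : Fin n → ℝ) (k : Fin n) :
    |b k| ≤ ‖unitaryConj U fun k => (b k : ℂ)‖ := by
  rw [norm_unitaryConj hU]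
  simpa using norm_le_pi_norm (fun k => (b k : ℂ)) k

theorem cos_pos_of_norm_angleConj_sub_one_lt {U : Matrix (Fin n) (Fin n) ℂ}
    (hU : U ∈ unitaryGroup (Fin n) ℂ) {φ : Fin n → ℝ}
    (h : ‖angleConj U φ - 1‖ < Real.sqrt 2) (k : Fin n) : 0 < Real.cos (φ k) := by
  rw [← unitaryConj_one hU, angleConj, sub_unitaryConj, norm_unitaryConj hU] at h
  have h1 := (norm_le_pi_norm (fun k => Complex.exp ((φ k : ℂ) * Complex.I) - 1) k).trans_lt h
  have h2 : ‖Complex.exp ((φ k : ℂ) * Complex.I) - 1‖ ^ 2 < 2 := by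
    have := pow_lt_pow_left₀ h1 (norm_nonneg _) two_ne_zero
    rwa [Real.sq_sqrt zero_le_two] at this
  rw [← Complex.normSq_eq_norm_sq, Complex.normSq_apply, Complex.sub_re, Complex.sub_im,
    Complex.exp_ofReal_mul_I_re, Complex.exp_ofReal_mul_I_im, Complex.one_re, Complex.one_im] at h2
  nlinarith [Real.sin_sq_add_cos_sq (φ k)]

theorem abs_lt_pi_div_two_of_cos_pos {r : ℝ} (hr : |r| < Real.pi) (hc : 0 < Real.cos r) :
    |r| < Real.pi / 2 := by
  by_contra! h
  rw [← Real.cos_abs] at hc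
  exact absurd (Real.cos_nonpos_of_pi_div_two_le_of_le h (by linarith [Real.pi_pos])) (not_le.2 hc)

/-- A matrix commuting with `e^{iy}`, where `iy` is a principal logarithm, commutes with `y`. -/
theorem commute_of_commute_exp {x y : Matrix (Fin n) (Fin n) ℂ} (hy : y.IsHermitian)
    (hlt : ‖y‖ < Real.pi) (h : Commute x (NormedSpace.exp (Complex.I • y))) : Commute x y := by
  obtain ⟨V, hV, b, rfl⟩ := exists_diagonalization hy
  have hb : ∀ k, |b k| < Real.pi := fun k => (norm_le_of_norm_unitaryConj hV b k).trans_lt hlt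
  rw [exp_I_smul_unitaryConj_one hV, angleConj] at h
  have conj_iff : ∀ d : Fin n → ℂ, Commute x (unitaryConj V d) ↔
      star V * x * V * diagonal d = diagonal d * (star V * x * V) := by
    intro d
    have e1 : star V * (x * unitaryConj V d) * V = star V * x * V * diagonal d := by
      simp only [unitaryConj, Matrix.mul_assoc, star_mul_of_mem hV, Matrix.mul_one]
    have e2 : star V * (unitaryConj V d * x) * V = diagonal d * (star V * x * V) := by
      rw [unitaryConj]
      simp only [← Matrix.mul_assoc, star_mul_of_mem hV, Matrix.one_mul]
    rw [commute_iff_eq, ← e1, ← e2]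
    refine ⟨fun h => by rw [h], fun h => ?_⟩
    have := congrArg (fun M => V * M * star V) h
    simpa only [← Matrix.mul_assoc, mul_star_of_mem hV, Matrix.one_mul,
      fun M : Matrix (Fin n) (Fin n) ℂ => show M * V * star V = M by
        rw [Matrix.mul_assoc, mul_star_of_mem hV, Matrix.mul_one]] using this
  rw [conj_iff] at h ⊢
  -- In the eigenbasis of `y`, a nonzero entry `(i, j)` of `x` forces `e^{i b j} = e^{i b i}`. Both
  -- angles lie in `(-π, π)`, so `b j = b i`.
  ext i j
  have hij := congrFun (congrFun h i) j
  rw [mul_diagonal, diagonal_mul] at hij ⊢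
  by_cases hx : (star V * x * V) i j = 0
  · rw [hx, zero_mul, mul_zero]
  · rw [mul_comm] at hij
    have := exp_mul_I_injOn (hb j) (hb i) (mul_right_cancel₀ hx hij)
    rw [this, mul_comm]

theorem isAnglePath_expPath {x y T : Matrix (Fin n) (Fin n) ℂ}
    (hy : y.IsHermitian) {t₀ : ℝ}
    (hu : ∀ t ∈ Set.Icc 0 t₀, ‖expPath x y t - 1‖ < Real.sqrt 2) {θ : ℝ → Fin n → ℝ}
    (hθ : ∀ t ∈ Set.Icc 0 t₀, IsEigenangles (expPath x y t) (θ t))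
    (hT : T ∈ unitaryGroup (Fin n) ℂ) {a : Fin n → ℝ} (hx : x = unitaryConj T fun k => (a k : ℂ)) :
    IsAnglePath T a (expPath x y) θ t₀ := by
  obtain ⟨V, hV, b, rfl⟩ := exists_diagonalization hy
  subst hx
  have hform : ∀ t, expPath (unitaryConj T fun k => (a k : ℂ)) (unitaryConj V fun k => (b k : ℂ)) t
      = angleConj T (fun k => t * a k) * angleConj V b := fun t => by
    rw [expPath, exp_I_smul_unitaryConj hT, exp_I_smul_unitaryConj_one hV]
  have hmem : ∀ t, expPath (unitaryConj T fun k => (a k : ℂ))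
      (unitaryConj V fun k => (b k : ℂ)) t ∈ unitaryGroup (Fin n) ℂ := fun t => by
    rw [hform]
    exact mul_mem (angleConj_mem hT _) (angleConj_mem hV _)
  refine ⟨hT, hmem, fun t s => ?_, fun t ht => (hθ t ht).exists_eq_angleConj (hmem t),
    fun t ht => (hθ t ht).antitone, fun t ht k => ?_⟩
  · rw [hform, hform, ← Matrix.mul_assoc, angleConj_mul hT]
    congr 2
    funext k
    ring
  · obtain ⟨U, hU, hUt⟩ := (hθ t ht).exists_eq_angleConj (hmem t)
    have h1 := hu t ht
    rw [hUt] at h1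
    exact abs_lt_pi_div_two_of_cos_pos (abs_lt.2 ((hθ t ht).mem_Ioo k))
      (cos_pos_of_norm_angleConj_sub_one_lt hU h1 k)

theorem trace_mul_unitaryConj_re (w : unitaryGroup (Fin n) ℂ) (V : Matrix (Fin n) (Fin n) ℂ)
    (μ θ : Fin n → ℝ) :
    (trace ((w : Matrix (Fin n) (Fin n) ℂ) * diagonal (fun k => (μ k : ℂ)) *
      ((w⁻¹ : unitaryGroup (Fin n) ℂ) : Matrix (Fin n) (Fin n) ℂ) *
        unitaryConj V fun k => (θ k : ℂ))).re =
      ∑ k, μ k * ∑ l, overlap (w : Matrix (Fin n) (Fin n) ℂ) V k l * θ l := by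
  have h1 : (w : Matrix (Fin n) (Fin n) ℂ) * diagonal (fun k => (μ k : ℂ)) *
      ((w⁻¹ : unitaryGroup (Fin n) ℂ) : Matrix (Fin n) (Fin n) ℂ) =
      unitaryConj w fun k => (μ k : ℂ) := rfl
  rw [h1, trace_unitaryConj_mul]
  simp only [star_mul_unitaryConj_mul_apply, ← Complex.ofReal_mul, ← Complex.ofReal_sum,
    Complex.ofReal_re]
  exact Finset.sum_congr rfl fun k _ => mul_comm _ _

/-- The weighted sum of the eigenangles is the maximum of the traces over the unitary orbit. -/
theorem isLUB_orbitTraces {u z : Matrix (Fin n) (Fin n) ℂ} {θ μ : Fin n → ℝ}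
    (hz : IsPrincipalArg u z) (hθ : IsEigenangles u θ) (hμ : Antitone μ) :
    IsLUB (orbitTraces μ z) (∑ k, μ k * θ k) := by
  obtain ⟨Z, hZ, φ, rfl⟩ := exists_diagonalization hz.isHermitian
  have hφ : ∀ k, |φ k| < Real.pi := fun k =>
    (norm_le_of_norm_unitaryConj hZ φ k).trans_lt hz.norm_lt
  have hu := hz.exp_eq
  rw [exp_I_smul_unitaryConj_one hZ] at hu
  rw [← hu] at hθ
  obtain ⟨σ, hσ⟩ := hθ.exists_perm_eq hZ hφ
  obtain ⟨V, hV, hVd⟩ := exists_unitaryConj_comp_perm hZ σ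
  have hzV : (unitaryConj Z fun k => (φ k : ℂ)) = unitaryConj V fun k => (θ k : ℂ) := by
    rw [hVd]
    simp only [hσ]
  rw [hzV]
  -- The supremum is attained at a unitary whose columns are eigenvectors of `z` ordered like `θ`,
  -- where the overlap matrix is the identity.
  refine IsGreatest.isLUB ⟨⟨⟨V, hV⟩, ?_⟩, ?_⟩
  · refine (trace_mul_unitaryConj_re ⟨V, hV⟩ V μ θ).trans ?_
    simp [overlap_self hV, one_apply]
  · rintro _ ⟨w, rfl⟩
    refine (trace_mul_unitaryConj_re w V μ θ).trans_le ?_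
    exact sum_mul_sum_le_of_mem_doublyStochastic (overlap_mem_doublyStochastic w.2 hV) hμ
      hθ.antitone

theorem piecewiseLinearOnIcc_of_commute {x y : Matrix (Fin n) (Fin n) ℂ}
    (hx : x.IsHermitian) (hy : y.IsHermitian) (hy_norm : ‖y‖ < Real.pi) {t₀ : ℝ} (ht₀ : 0 < t₀)
    (hu : ∀ t ∈ Set.Icc 0 t₀, ‖expPath x y t - 1‖ < Real.sqrt 2) {θ : ℝ → Fin n → ℝ}
    (hθ : ∀ t ∈ Set.Icc 0 t₀, IsEigenangles (expPath x y t) (θ t)) {μ : Fin n → ℝ}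
    (hμ : Antitone μ) (hxy : Commute x y) :
    PiecewiseLinearOnIcc (weightedAngleSum μ θ) 0 t₀ := by
  obtain ⟨U, hU, a, b, rfl, rfl⟩ := exists_joint_diagonalization hx hy hxy
  have hform : ∀ t, expPath (unitaryConj U fun k => (a k : ℂ)) (unitaryConj U fun k => (b k : ℂ)) t
      = angleConj U fun k => t * a k + b k := fun t => by
    rw [expPath, exp_I_smul_unitaryConj hU, exp_I_smul_unitaryConj_one hU, angleConj_mul hU]
  simp only [hform] at hu hθ
  have hcos : ∀ t ∈ Set.Icc 0 t₀, ∀ k, 0 < Real.cos (t * a k + b k) := fun t ht k =>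
    cos_pos_of_norm_angleConj_sub_one_lt hU (hu t ht) k
  have hlt : ∀ t ∈ Set.Icc 0 t₀, ∀ k, |t * a k + b k| < Real.pi := by
    intro t ht k
    -- The joint eigenvalue phases start within `π/2` of zero and can never reach `±π/2`, where the
    -- cosine vanishes. By continuity they are therefore the principal angles for all `t`.
    suffices |t * a k + b k| < Real.pi / 2 by linarith [Real.pi_pos]
    have h0 : |0 * a k + b k| < Real.pi / 2 := by
      refine abs_lt_pi_div_two_of_cos_pos ?_ (hcos 0 ⟨le_rfl, ht₀.le⟩ k)
      rw [zero_mul, zero_add]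
      exact (norm_le_of_norm_unitaryConj hU b k).trans_lt hy_norm
    by_contra! hcon
    have hcont : ContinuousOn (fun r : ℝ => |r * a k + b k|) (Set.Icc 0 t) := by fun_prop
    obtain ⟨r, hr, hreq⟩ := intermediate_value_Icc ht.1 hcont ⟨h0.le, hcon⟩
    have h1 := hcos r ⟨hr.1, hr.2.trans ht.2⟩ k
    have h2 : |r * a k + b k| = Real.pi / 2 := hreq
    rw [← Real.cos_abs, h2, Real.cos_pi_div_two] at h1
    exact lt_irrefl _ h1
  refine piecewiseLinearOnIcc_of_isMax (ι := Equiv.Perm (Fin n))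
    (c := fun σ => ∑ k, μ k * a (σ k)) (d := fun σ => ∑ k, μ k * b (σ k)) ht₀ ?_ ?_
  · intro t ht τ
    obtain ⟨σ, hσ⟩ := (hθ t ht).exists_perm_eq hU (hlt t ht)
    have hmono : Monovary μ (θ t) := hμ.monovary (hθ t ht).antitone
    refine le_trans (le_of_eq ?_) (hmono.sum_mul_comp_perm_le_sum_mul (σ := τ.trans σ.symm))
    rw [Finset.sum_mul, ← Finset.sum_add_distrib]
    refine Finset.sum_congr rfl fun k _ => ?_
    rw [hσ, Equiv.trans_apply, Equiv.apply_symm_apply]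
    ring
  · intro t ht
    obtain ⟨σ, hσ⟩ := (hθ t ht).exists_perm_eq hU (hlt t ht)
    refine ⟨σ, ?_⟩
    rw [weightedAngleSum, Finset.sum_mul, ← Finset.sum_add_distrib]
    refine Finset.sum_congr rfl fun k _ => ?_
    rw [hσ]
    ring

theorem PiecewiseLinearOnIcc.not_strictConvexOn {f : ℝ → ℝ} {a b : ℝ} (hab : a < b)
    (h : PiecewiseLinearOnIcc f a b) : ¬ StrictConvexOn ℝ (Set.Icc a b) f := by
  obtain ⟨N, s, hs, h0, hN, hlin⟩ := h
  rcases N with _ | N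
  · exact absurd (h0.symm.trans hN) hab.ne
  · refine (hlin 0).not_strictConvexOn (by rw [Fin.castSucc_zero, h0])
      (hs Fin.castSucc_lt_succ) ?_
    rw [← hN]
    exact hs.monotone (Fin.le_last _)

/-- Differences of consecutive partial sums are the individual angles, so rigidity makes `x`
diagonal in an eigenbasis of `u(t)`. In `hlin`, `m = 0` contributes only the empty sum. -/
theorem commute_of_linearOnIcc {x y : Matrix (Fin n) (Fin n) ℂ}
    (hx : x.IsHermitian) (hy : y.IsHermitian) (hy_norm : ‖y‖ < Real.pi) {t₀ : ℝ} (ht₀ : 0 < t₀)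
    (hu : ∀ t ∈ Set.Icc 0 t₀, ‖expPath x y t - 1‖ < Real.sqrt 2) {θ : ℝ → Fin n → ℝ}
    (hθ : ∀ t ∈ Set.Icc 0 t₀, IsEigenangles (expPath x y t) (θ t)) {p q : ℝ} (hp : 0 ≤ p)
    (hpq : p < q) (hq : q ≤ t₀)
    (hlin : ∀ m : Fin n, LinearOnIcc (fun t => ∑ k ∈ Finset.Iio m, θ t k) p q) :
    Commute x y := by
  obtain ⟨T, hT, a, hxT⟩ := exists_diagonalization hx
  have hpath := isAnglePath_expPath hy hu hθ hT hxT
  have hIic : ∀ m : Fin n, LinearOnIcc (fun t => ∑ k ∈ Finset.Iic m, θ t k) p q := by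
    intro m
    by_cases hm : m.val + 1 < n
    · have : Finset.Iic m = Finset.Iio ⟨m.val + 1, hm⟩ := by
        ext k
        simp only [Finset.mem_Iic, Finset.mem_Iio, Fin.le_def, Fin.lt_def]
        omega
      rw [this]
      exact hlin _
    -- The full sum is not among the hypotheses; it is linear on the whole segment by
    -- `linearOnIcc_sum`.
    · have : Finset.Iic m = Finset.univ := by
        ext k
        simp only [Finset.mem_Iic, Finset.mem_univ, Fin.le_def, iff_true]
        omega
      rw [this]
      exact (hpath.linearOnIcc_sum ht₀).mono hp hq
  have hθlin : ∀ k, LinearOnIcc (fun t => θ t k) p q := by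
    intro k
    have h1 := (hIic k).sub (hlin k)
    have : (fun t => ∑ j ∈ Finset.Iic k, θ t j - ∑ j ∈ Finset.Iio k, θ t j) =
        fun t => θ t k := by
      funext t
      rw [← Finset.Iio_insert, Finset.sum_insert (by simp), add_sub_cancel_right]
    rwa [this] at h1
  choose c d hcd using hθlin
  have hmid : (p + q) / 2 ∈ Set.Ioo p q := ⟨by linarith, by linarith⟩
  set t := (p + q) / 2
  obtain ⟨U, hU, hUt⟩ := hpath.exists_eq t ⟨by linarith [hmid.1], by linarith [hmid.2]⟩
  have hxU : x = unitaryConj U fun k => (c k : ℂ) := by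
    rw [hxT]
    exact hpath.unitaryConj_eq hp hq (fun r hr k => hcd k r ⟨hr.1.le, hr.2.le⟩) hmid hU hUt
  refine commute_of_commute_exp hy hy_norm ?_
  have hexp : NormedSpace.exp (Complex.I • y) = angleConj U fun k => -t * c k + θ t k := by
    rw [← angleConj_mul hU, ← hUt, expPath, ← Matrix.mul_assoc, hxU, exp_I_smul_unitaryConj hU,
      angleConj_mul hU]
    simp only [neg_mul, neg_add_cancel, angleConj_zero hU, Matrix.one_mul]
  rw [hexp, hxU, angleConj, commute_iff_eq, unitaryConj_mul hU, unitaryConj_mul hU]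
  simp only [mul_comm]

theorem strictConvexOn_of_not_commute {x y : Matrix (Fin n) (Fin n) ℂ}
    (hx : x.IsHermitian) (hy : y.IsHermitian) (hy_norm : ‖y‖ < Real.pi) {t₀ : ℝ} (ht₀ : 0 < t₀)
    (hu : ∀ t ∈ Set.Icc 0 t₀, ‖expPath x y t - 1‖ < Real.sqrt 2) {θ : ℝ → Fin n → ℝ}
    (hθ : ∀ t ∈ Set.Icc 0 t₀, IsEigenangles (expPath x y t) (θ t)) {μ : Fin n → ℝ}
    (hμ : StrictAnti μ) (hxy : ¬ Commute x y) :
    StrictConvexOn ℝ (Set.Icc 0 t₀) (weightedAngleSum μ θ) := by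
  obtain ⟨T, hT, a, hxT⟩ := exists_diagonalization hx
  have hpath := isAnglePath_expPath hy hu hθ hT hxT
  refine LinearOrder.strictConvexOn_of_lt (convex_Icc 0 t₀) fun p hp q hq hpq u v hu' hv' huv => ?_
  by_contra! hcon
  simp only [smul_eq_mul] at hcon
  refine hxy (commute_of_linearOnIcc hx hy hy_norm ht₀ hu hθ hp.1 hpq hq.2 fun m => ?_)
  rcases Nat.eq_zero_or_pos m.val with hm | hm
  · refine ⟨0, 0, fun t _ => ?_⟩
    have : Finset.Iio m = ∅ := by
      ext k
      simp only [Finset.mem_Iio, Fin.lt_def, Finset.notMem_empty, iff_false]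
      omega
    simp [this]
  · set m' : Fin n := ⟨m.val - 1, by omega⟩ with hm'
    -- The gap at the jump of the indicator is the largest multiple of it that can be subtracted
    -- from `μ` leaving a non-increasing sequence. Both summands give convex functions, so equality
    -- in the chord inequality for `μ` passes to the indicator.
    set ε := μ m' - μ m with hε
    have hε0 : 0 < ε := sub_pos.2 (hμ (by rw [Fin.lt_def]; simp only [hm']; omega))
    set χ : Fin n → ℝ := fun k => if k ∈ Finset.Iio m then 1 else 0 with hχ
    have hχanti : Antitone χ := antitone_indicator (by rw [Finset.coe_Iio]; exact isLowerSet_Iio m)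
    have hdiff : Antitone fun k => μ k - ε * χ k := by
      intro i j hij
      simp only [hχ, Finset.mem_Iio]
      have h1 := hμ.antitone hij
      by_cases hj : j < m
      · simp only [hj, hij.trans_lt hj, if_true]
        linarith
      · by_cases hi : i < m
        · simp only [hi, hj, if_true, if_false]
          have h2 : μ m' ≤ μ i := hμ.antitone (by
            rw [Fin.lt_def] at hi
            rw [Fin.le_def]; simp only [hm']; omega)
          have h3 : μ j ≤ μ m := hμ.antitone (not_lt.1 hj)
          linarith
        · simp only [hi, hj, if_false]
          linarith
    have hsum : (fun t => ∑ k ∈ Finset.Iio m, θ t k) = weightedAngleSum χ θ := by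
      funext t
      simp [weightedAngleSum, hχ, -Finset.mem_Iio]
    have hsplit : ∀ t, weightedAngleSum μ θ t =
        ε * weightedAngleSum χ θ t + weightedAngleSum (fun k => μ k - ε * χ k) θ t := by
      intro t
      rw [weightedAngleSum, weightedAngleSum, weightedAngleSum, Finset.mul_sum,
        ← Finset.sum_add_distrib]
      exact Finset.sum_congr rfl fun k _ => by ring
    rw [hsum]
    refine linearOnIcc_of_convexOn_of_eq hpq ((hpath.convexOn hχanti).subset
      (Set.Icc_subset_Icc hp.1 hq.2) (convex_Icc p q)) hu' hv' huv ?_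
    have h1 := (hpath.convexOn hdiff).2 hp hq hu'.le hv'.le huv
    simp only [smul_eq_mul] at h1
    simp only [hsplit] at hcon
    refine le_of_mul_le_mul_left ?_ hε0
    linarith

end Segment

end UnitarySegment

theorem theorem5p10 {n : ℕ} (x y : Matrix (Fin n) (Fin n) ℂ)
    (hx : x.IsHermitian) (hy : y.IsHermitian) (hy_norm : ‖y‖ < Real.pi)
    (t₀ : ℝ) (ht₀ : 0 < t₀)
    (hu : ∀ t ∈ Set.Icc 0 t₀, ‖UnitarySegment.expPath x y t - 1‖ < Real.sqrt 2)
    (z : ℝ → Matrix (Fin n) (Fin n) ℂ)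
    (hz : ∀ t ∈ Set.Icc 0 t₀, UnitarySegment.IsPrincipalArg (UnitarySegment.expPath x y t) (z t))
    (θ : ℝ → Fin n → ℝ)
    (hθ : ∀ t ∈ Set.Icc 0 t₀, UnitarySegment.IsEigenangles (UnitarySegment.expPath x y t) (θ t))
    (μ : Fin n → ℝ) (hμ : StrictAnti μ) :
    (∀ t ∈ Set.Icc 0 t₀,
      IsLUB (UnitarySegment.orbitTraces μ (z t)) (UnitarySegment.weightedAngleSum μ θ t)) ∧
    (StrictConvexOn ℝ (Set.Icc 0 t₀) (UnitarySegment.weightedAngleSum μ θ) ↔ ¬ Commute x y) ∧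
    (Commute x y →
      UnitarySegment.PiecewiseLinearOnIcc (UnitarySegment.weightedAngleSum μ θ) 0 t₀) ∧
    (∀ a b : ℝ, 0 ≤ a → a < b → b ≤ t₀ →
      (∀ m : Fin n, UnitarySegment.LinearOnIcc (fun t => ∑ k ∈ Finset.Iio m, θ t k) a b) →
      Commute x y) := by
  have hpl : Commute x y →
      UnitarySegment.PiecewiseLinearOnIcc (UnitarySegment.weightedAngleSum μ θ) 0 t₀ :=
    UnitarySegment.piecewiseLinearOnIcc_of_commute hx hy hy_norm ht₀ hu hθ hμ.antitone
  refine ⟨fun t ht => UnitarySegment.isLUB_orbitTraces (hz t ht) (hθ t ht) hμ.antitone,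
    ⟨fun hsc hxy => (hpl hxy).not_strictConvexOn ht₀ hsc,
      UnitarySegment.strictConvexOn_of_not_commute hx hy hy_norm ht₀ hu hθ hμ⟩, hpl,
    fun a b ha hab hb =>
      UnitarySegment.commute_of_linearOnIcc hx hy hy_norm ht₀ hu hθ ha hab hb⟩
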